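/- For a permutation $x\in S_n$ with $a_i$ cycles of length $i$ ($i\ge 1$), the centralizer is $Z_x\cong\prod_{i\ge1} G_i\wr S_{a_i}$, where $G_i$ is cyclic of order $i$, generated by an $i$-cycle. Let $\omega^x$ be the linear character of $Z_x$ whose restriction to each factor $G_i\wr S_{a_i}$ is equal to a primitive irreducible character on (each copy of) $G_i$ and trivial on the wreathing group $S_{a_i}$. The higher Lie character of $x$ is the induced character $\psi^x_{S_n}:=\omega^x\uparrow_{Z_x}^{S_n}$; it depends only on the cycle type $\lambda\vdash n$ of $x$ and is denoted $\psi^\lambda_{S_n}$. For $\nu\vdash n$, write $\psi^\lambda_{S_n}(\nu)$ for its value at elements of cycle type $\nu$. Let $\mathrm{OP}(n)$ be the set of partitions of $n$ all of whose parts are odd ($\mathrm{OP}(0)$ consists of the empty partition). For $\nu\vdash n$ with $b_j$ parts of size $j$ ($j\ge1$), let $|Z_\nu|=\prod_j b_j!\,j^{b_j}$ be the order of the centralizer in $S_n$ of an element of cycle type $\nu$, and let $\mathbf t^{c(\nu)}:=\prod_j t_j^{b_j}$, where $\mathbf t=(t_j)_{j\ge1}$ are indeterminates. **Theorem.** In the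 ring $\mathbb C[[\mathbf t]]$ of formal power series, $$\sum_{n\ge0}\ \sum_{\lambda\in \mathrm{OP}(n)}\ \sum_{\nu\vdash n}\psi^\lambda_{S_n}(\nu)\,\frac{\mathbf t^{c(\nu)}}{|Z_\nu|}\;=\;\prod_{p\ge0}\left(\frac{1+t_{2^p}}{1-t_{2^p}}\right)^{1/2^{p+1}},$$ where the power $F^r$ of a formal power series $F$ with constant term $1$ is $\exp(r\log F)$, and the infinite sum and product converge coefficientwise (each coefficient is eventually constant). -/

import Mathlib

noncomputable section

namespace HigherLie

open Equiv Equiv.Perm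

section LinearCharacter

variable {α : Type*}

/-- The length of the cycle of `x` that contains `a` (fixed points are cycles of length `1`). -/
def cycleLength (x : Perm α) (a : α) : ℕ := Function.minimalPeriod x a

/-- The set of all cycles of `x`, fixed points included, as the set of orbits of `x`. -/
abbrev Cycles (x : Perm α) : Type _ := Quotient (SameCycle.setoid x)

instance [Finite α] (x : Perm α) : Fintype (Cycles x) := Fintype.ofFinite _

/-- The cycle of `x` that contains `a`. -/
def cycleOfPoint (x : Perm α) (a : α) : Cycles x := Quotient.mk (SameCycle.setoid x) a

/-- A chosen base point on each cycle of `x`. -/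
def basePoint (x : Perm α) (q : Cycles x) : α := Quotient.out q

theorem cycleOfPoint_basePoint (x : Perm α) (q : Cycles x) :
    cycleOfPoint x (basePoint x q) = q := Quotient.out_eq q

theorem cycleOfPoint_eq_iff (x : Perm α) {a b : α} :
    cycleOfPoint x a = cycleOfPoint x b ↔ x.SameCycle a b := Quotient.eq

theorem sameCycle_basePoint (x : Perm α) (a : α) :
    x.SameCycle (basePoint x (cycleOfPoint x a)) a :=
  (cycleOfPoint_eq_iff x).1 (cycleOfPoint_basePoint x _)

/-- The position of `a` on its cycle: an integer `k` such that `x ^ k` takes the base point of the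
cycle to `a`. It is unique modulo the length of the cycle. -/
def position (x : Perm α) (a : α) : ℤ := (sameCycle_basePoint x a).choose

theorem position_spec (x : Perm α) (a : α) :
    (x ^ position x a) (basePoint x (cycleOfPoint x a)) = a :=
  (sameCycle_basePoint x a).choose_spec

/-- `ζ ^ k`, where `k` is the position of `a` on its cycle, of length `i`, and `ζ = ζ i`. -/
def phase (ζ : ℕ → ℂ) (x : Perm α) (a : α) : ℂ := ζ (cycleLength x a) ^ position x a

theorem cycleLength_pos [Finite α] (x : Perm α) (a : α) : 0 < cycleLength x a :=
  Function.minimalPeriod_pos_of_mem_periodicPts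
    (Function.mem_periodicPts.2 ⟨orderOf x, orderOf_pos x, by
      simp [Function.IsPeriodicPt, Function.IsFixedPt, ← Equiv.Perm.coe_pow, pow_orderOf_eq_one]⟩)

theorem zpow_apply_eq_iff (x : Perm α) (a : α) (k : ℤ) :
    (x ^ k) a = a ↔ (cycleLength x a : ℤ) ∣ k :=
  MulAction.zpow_smul_eq_iff_minimalPeriod_dvd (a := x) (b := a) (n := k)

theorem cycleLength_congr (x : Perm α) {a b : α} (h : ∀ k : ℤ, (x ^ k) a = a ↔ (x ^ k) b = b) :
    cycleLength x a = cycleLength x b := by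
  apply Nat.dvd_antisymm
  · have := (zpow_apply_eq_iff x a (cycleLength x b)).1
      ((h _).2 ((zpow_apply_eq_iff x b _).2 dvd_rfl))
    exact_mod_cast this
  · have := (zpow_apply_eq_iff x b (cycleLength x a)).1
      ((h _).1 ((zpow_apply_eq_iff x a _).2 dvd_rfl))
    exact_mod_cast this

theorem commute_zpow_apply {x z : Perm α} (hz : Commute z x) (k : ℤ) (a : α) :
    z ((x ^ k) a) = (x ^ k) (z a) := by
  have := (hz.zpow_right k).eq
  exact congrArg (fun f : Perm α => f a) this

theorem cycleLength_apply {x z : Perm α} (hz : Commute z x) (a : α) :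
    cycleLength x (z a) = cycleLength x a :=
  cycleLength_congr x fun k => by
    rw [← commute_zpow_apply hz, z.injective.eq_iff]

theorem cycleOfPoint_zpow (x : Perm α) (k : ℤ) (a : α) :
    cycleOfPoint x ((x ^ k) a) = cycleOfPoint x a :=
  (cycleOfPoint_eq_iff x).2 (SameCycle.symm ⟨k, rfl⟩)

theorem root_ne_zero [Finite α] {ζ : ℕ → ℂ} (hζ : ∀ i, 0 < i → IsPrimitiveRoot (ζ i) i)
    (x : Perm α) (a : α) : ζ (cycleLength x a) ≠ 0 :=
  (hζ _ (cycleLength_pos x a)).ne_zero (cycleLength_pos x a).ne'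

theorem phase_eq [Finite α] {ζ : ℕ → ℂ} (hζ : ∀ i, 0 < i → IsPrimitiveRoot (ζ i) i)
    (x : Perm α) (a : α) (k : ℤ)
    (h : (x ^ k) (basePoint x (cycleOfPoint x a)) = a) :
    phase ζ x a = ζ (cycleLength x a) ^ k := by
  have h1 := position_spec x a
  have h2 : (x ^ (position x a - k)) a = a := by
    have h' : (x ^ (-k)) a = basePoint x (cycleOfPoint x a) := by
      rw [zpow_neg, Perm.inv_eq_iff_eq, h]
    rw [sub_eq_add_neg, zpow_add, Perm.mul_apply, h', h1]
  have h3 := (zpow_apply_eq_iff x a _).1 h2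
  have h4 := ((hζ _ (cycleLength_pos x a)).zpow_eq_one_iff_dvd _).2 h3
  rw [zpow_sub₀ (root_ne_zero hζ x a), div_eq_one_iff_eq
    (zpow_ne_zero _ (root_ne_zero hζ x a))] at h4
  exact h4

theorem phase_zpow [Finite α] {ζ : ℕ → ℂ} (hζ : ∀ i, 0 < i → IsPrimitiveRoot (ζ i) i)
    (x : Perm α) (k : ℤ) (a : α) :
    phase ζ x ((x ^ k) a) = ζ (cycleLength x a) ^ k * phase ζ x a := by
  have hl : cycleLength x ((x ^ k) a) = cycleLength x a :=
    cycleLength_apply ((Commute.refl x).zpow_left k) a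
  rw [phase_eq hζ x ((x ^ k) a) (k + position x a), hl, zpow_add₀ (root_ne_zero hζ x a), phase]
  rw [cycleOfPoint_zpow, zpow_add, Perm.mul_apply, position_spec]

theorem phase_basePoint [Finite α] {ζ : ℕ → ℂ} (hζ : ∀ i, 0 < i → IsPrimitiveRoot (ζ i) i)
    (x : Perm α) (q : Cycles x) : phase ζ x (basePoint x q) = 1 := by
  rw [phase_eq hζ x _ 0, zpow_zero]
  rw [zpow_zero, Perm.one_apply, cycleOfPoint_basePoint]

theorem phase_mul [Finite α] {ζ : ℕ → ℂ} (hζ : ∀ i, 0 < i → IsPrimitiveRoot (ζ i) i)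
    {x z : Perm α} (hz : Commute z x) (a : α) :
    phase ζ x (z a) = phase ζ x (z (basePoint x (cycleOfPoint x a))) * phase ζ x a := by
  conv_lhs => rw [← position_spec x a]
  rw [commute_zpow_apply hz, phase_zpow hζ, cycleLength_apply hz, mul_comm, phase]
  have hl := cycleLength_apply ((Commute.refl x).zpow_left (position x a))
    (basePoint x (cycleOfPoint x a))
  rw [position_spec] at hl
  rw [← hl]
  rfl

/-- The permutation of the set of cycles of `x` that is induced by an element of the
centralizer of `x`. -/
def cycleAction {x z : Perm α} (hz : Commute z x) : Perm (Cycles x) :=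
  Quotient.congr z fun a b => by
    constructor
    · rintro ⟨k, rfl⟩
      exact ⟨k, (commute_zpow_apply hz k a).symm⟩
    · rintro ⟨k, h⟩
      exact ⟨k, z.injective (by rw [commute_zpow_apply hz, h])⟩

theorem cycleAction_apply {x z : Perm α} (hz : Commute z x) (q : Cycles x) :
    cycleAction hz q = cycleOfPoint x (z (basePoint x q)) := by
  conv_lhs => rw [← cycleOfPoint_basePoint x q]
  rfl

theorem commute_of_mem {x : Perm α} (z : Subgroup.centralizer ({x} : Set (Perm α))) :
    Commute (z : Perm α) x := (Subgroup.mem_centralizer_singleton_iff.1 z.2)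

/-- The linear character `ω^x` of the centralizer `Z_x`, for given primitive roots of unity `ζ i`.

Let `z ∈ Z_x`. It takes the base point of a cycle `q` of length `i` to the `k`-th point,
counted from the base point along `x`, of a cycle of the same length. In
`Z_x ≅ ∏ i, G_i ≀ S_{a_i}` the residue `k` modulo `i` is the component of `z` in the copy of
`G_i` attached to `q`, and the permutations of the cycles that take base points to base points
form the wreathing groups `S_{a_i}`. Thus `ω^x`, the product over all `q` of the `ζ i ^ k`, is
on each copy of `G_i` the primitive character that takes the generator (the cycle of `x`)
to `ζ i`, and it is trivial on the `S_{a_i}`. -/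
def omega [Finite α] {ζ : ℕ → ℂ} (hζ : ∀ i, 0 < i → IsPrimitiveRoot (ζ i) i)
    (x : Perm α) : Subgroup.centralizer ({x} : Set (Perm α)) →* ℂ where
  toFun z := ∏ q : Cycles x, phase ζ x ((z : Perm α) (basePoint x q))
  map_one' := by
    simp [phase_basePoint hζ]
  map_mul' z w := by
    have hz := commute_of_mem z
    have hw := commute_of_mem w
    simp only [Subgroup.coe_mul, Perm.mul_apply]
    simp_rw [phase_mul hζ hz ((w : Perm α) (basePoint x _)), ← cycleAction_apply hw]
    rw [Finset.prod_mul_distrib]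
    congr 1
    exact Equiv.prod_comp (cycleAction hw)
      fun q => phase ζ x ((z : Perm α) (basePoint x q))

end LinearCharacter

open Classical in
/-- The character of `G` induced from a linear character `χ` of a subgroup `H`. -/
def inducedChar {G : Type*} [Group G] [Fintype G] (H : Subgroup G) (χ : H →* ℂ) (g : G) : ℂ :=
  (Nat.card H : ℂ)⁻¹ * ∑ a : G, if h : a⁻¹ * g * a ∈ H then χ ⟨a⁻¹ * g * a, h⟩ else 0

/-- `x` has cycle type `μ`, where fixed points count as parts equal to `1`. -/
def HasCycleType {n : ℕ} (x : Perm (Fin n)) (μ : n.Partition) : Prop :=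
  x.partition.parts = μ.parts

theorem exists_hasCycleType {n : ℕ} (μ : n.Partition) : ∃ x : Perm (Fin n), HasCycleType x μ := by
  obtain ⟨x, hx⟩ := (exists_with_cycleType_iff (Fin n) (m := μ.parts.filter (2 ≤ ·))).2 ⟨by
    rw [Fintype.card_fin]
    conv_rhs => rw [← μ.parts_sum, ← Multiset.filter_add_not (2 ≤ ·) μ.parts, Multiset.sum_add]
    exact Nat.le_add_right _ _, fun a ha => (Multiset.mem_filter.1 ha).2⟩
  refine ⟨x, ?_⟩
  have h1 : μ.parts.filter (fun a => ¬ 2 ≤ a) =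
      Multiset.replicate (μ.parts.filter (fun a => ¬ 2 ≤ a)).card 1 :=
    Multiset.eq_replicate_card.2 fun b hb => by
      have h2 := Multiset.mem_filter.1 hb
      have := μ.parts_pos h2.1
      omega
  have h3 : n = x.cycleType.sum + (μ.parts.filter (fun a => ¬ 2 ≤ a)).card := by
    conv_lhs => rw [← μ.parts_sum, ← Multiset.filter_add_not (2 ≤ ·) μ.parts, Multiset.sum_add,
      h1, Multiset.sum_replicate, smul_eq_mul, mul_one]
    rw [hx]
  rw [HasCycleType, parts_partition, ← sum_cycleType, Fintype.card_fin]
  conv_rhs => rw [← Multiset.filter_add_not (2 ≤ ·) μ.parts, h1]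
  rw [hx]
  congr 2
  rw [hx] at h3
  omega

/-- A permutation of cycle type `μ`. -/
def representative {n : ℕ} (μ : n.Partition) : Perm (Fin n) := (exists_hasCycleType μ).choose

theorem hasCycleType_representative {n : ℕ} (μ : n.Partition) :
    HasCycleType (representative μ) μ := (exists_hasCycleType μ).choose_spec

section HigherLieCharacter

variable {ζ : ℕ → ℂ} (hζ : ∀ i, 0 < i → IsPrimitiveRoot (ζ i) i)

/-- The higher Lie character `ψ^x` of `S_n`, as a function on `S_n`. -/
def psiPerm {n : ℕ} (x : Perm (Fin n)) : Perm (Fin n) → ℂ :=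
  inducedChar (Subgroup.centralizer {x}) (omega hζ x)

/-- The value `ψ^μ(ν)` of the higher Lie character of the cycle type `μ` at the elements of
cycle type `ν`. It depends only on the cycle types, not on the representatives. -/
def psi {n : ℕ} (μ ν : n.Partition) : ℂ := psiPerm hζ (representative μ) (representative ν)

end HigherLieCharacter

/-- The order of the centralizer in `S_n` of an element of cycle type `ν`. -/
def centralizerCard {n : ℕ} (ν : n.Partition) : ℕ :=
  Nat.card (Subgroup.centralizer ({representative ν} : Set (Perm (Fin n))))

/-- The ring of formal power series over `ℂ` in the indeterminates `t j`, for `j ≥ 1`. -/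
abbrev Series : Type := MvPowerSeries ℕ+ ℂ

/-- The topology of formal convergence: the coefficients carry the discrete topology, so a
net converges if and only if each of its coefficients is eventually constant. -/
instance formalTopology : TopologicalSpace Series :=
  @MvPowerSeries.WithPiTopology.instTopologicalSpace ℕ+ ℂ ⊥

/-- The indeterminate `t j`. -/
def t (j : ℕ+) : Series := MvPowerSeries.X j

/-- The monomial `∏ j, t j ^ b j`, where `b j` is the number of parts of size `j` in `ν`. -/
def tMonomial {n : ℕ} (ν : n.Partition) : Series :=
  ∏ j ∈ Finset.range n, t j.succPNat ^ ν.parts.count (j + 1)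

/-- The logarithm of a formal power series with constant term `1`. -/
def formalLog (F : Series) : Series := (PowerSeries.log ℂ).subst (F - 1)

/-- The power `F ^ r = exp (r * log F)` of a formal power series `F` with constant term `1`. -/
def formalPow (F : Series) (r : ℂ) : Series := (PowerSeries.exp ℂ).subst (r • formalLog F)

end HigherLie

end

/-! An induced character value is a sum over conjugates (`psiPerm_eq_sum`). Averaging over `g` in
place of summing over cycle types, the degree `n` part of the left side becomes `1/n!` times a sum
over commuting pairs `(y, g)` in `S_n`, with all cycles of `y` odd, of `ω^y(g)` times the cycle type
monomial of `g` (`sum_psi_eq`). This weight is multiplicative over disjoint unions of invariant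
sets, so the exponential formula (`pairSum_eq`) reduces everything to pairs that generate a
transitive group.

On `k` points, a transitive pair consists of `k/i` cycles of `y` of common length `i`, which `g`
permutes cyclically, returning to the first one with a shift `j` modulo `i`. Its weight is `ζ_i^j
t_l^(k/l)` with `l = (k/i) * ord(j)`, and each `(i, j)` comes from `(k-1)!` pairs. The shifts of
order `e` contribute the sum of the primitive `e`-th roots of unity, which is the Möbius function of
`e`. Möbius inversion over the divisors of the odd part `K` of `k` leaves the single monomial
`t_(k/K)^K` (`transSum_eq`).

Hence the left side `Z` satisfies `E Z = Z * ∑_k t_(k/K)^K`, where `E` is the Euler derivation for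
the grading `deg t_j = j`. Since `k = 2^p * d` with `d` odd in exactly one way, the sum over `k`
splits into the series `t + t^3 + t^5 + ⋯ = t/(1-t^2)` at `t = t_(2^p)`, and each of these is the
logarithmic Euler derivative of one factor of the product (`euler_factor`). A series with constant
term `1` is determined by its logarithmic Euler derivative (`coeff_eq_of_euler_eq`), so the two
sides agree. -/

noncomputable section

namespace HigherLie

open Equiv Equiv.Perm

universe u

/-! ### Weighted degree and the Euler derivation -/

section SeriesLemmas

/-- The degree of a monomial, where the indeterminate `t j` has degree `j`. -/
def weightedDegree : (ℕ+ →₀ ℕ) →+ ℕ := Finsupp.weight fun j : ℕ+ => (j : ℕ)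

theorem weightedDegree_single (j : ℕ+) (d : ℕ) :
    weightedDegree (Finsupp.single j d) = d * j := by
  simp [weightedDegree, Finsupp.weight_single]

theorem weightedDegree_eq_zero_iff (s : ℕ+ →₀ ℕ) : weightedDegree s = 0 ↔ s = 0 := by
  refine ⟨fun h => ?_, fun h => by simp [h]⟩
  ext j
  have h1 := Finsupp.le_weight (fun j : ℕ+ => (j : ℕ)) (s := j) j.pos.ne' s
  change s j ≤ weightedDegree s at h1
  simpa [h] using h1

/-- The Euler derivation, which multiplies a monomial by its weighted degree. -/
def euler (f : Series) : Series := fun s => (weightedDegree s : ℂ) * MvPowerSeries.coeff s f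

theorem coeff_euler (f : Series) (s : ℕ+ →₀ ℕ) :
    MvPowerSeries.coeff s (euler f) = (weightedDegree s : ℂ) * MvPowerSeries.coeff s f := rfl

theorem euler_mul (f g : Series) : euler (f * g) = euler f * g + f * euler g := by
  classical
  ext s
  simp only [map_add, coeff_euler, MvPowerSeries.coeff_mul, Finset.mul_sum]
  rw [← Finset.sum_add_distrib]
  refine Finset.sum_congr rfl fun p hp => ?_
  rw [← Finset.HasAntidiagonal.mem_antidiagonal.1 hp, map_add]
  push_cast
  ring

theorem euler_one : euler 1 = 0 := by
  classical
  ext s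
  rw [coeff_euler, MvPowerSeries.coeff_one]
  split_ifs with h <;> simp [h]

theorem euler_prod {ι : Type*} (S : Finset ι) (f l : ι → Series)
    (h : ∀ i ∈ S, euler (f i) = f i * l i) :
    euler (∏ i ∈ S, f i) = (∏ i ∈ S, f i) * ∑ i ∈ S, l i := by
  classical
  induction S using Finset.induction_on with
  | empty => simp [euler_one]
  | insert a S ha ih =>
    rw [Finset.prod_insert ha, Finset.sum_insert ha, euler_mul, h a (Finset.mem_insert_self _ _),
      ih fun i hi => h i (Finset.mem_insert_of_mem hi)]
    ring

/-- A series is determined by its constant coefficient and its logarithmic Euler derivative,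
and each coefficient depends on finitely many coefficients of the latter. -/
theorem coeff_eq_of_euler_eq {A B l m : Series} (hA : euler A = A * l) (hB : euler B = B * m)
    (h0 : MvPowerSeries.constantCoeff A = MvPowerSeries.constantCoeff B)
    (hl0 : MvPowerSeries.constantCoeff l = 0) (s : ℕ+ →₀ ℕ)
    (hlm : ∀ v ≤ s, MvPowerSeries.coeff v l = MvPowerSeries.coeff v m) :
    MvPowerSeries.coeff s A = MvPowerSeries.coeff s B := by
  classical
  induction hn : weightedDegree s using Nat.strong_induction_on generalizing s with
  | _ n ih =>
  by_cases hs : s = 0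
  · subst hs
    simpa using h0
  have hw : (weightedDegree s : ℂ) ≠ 0 := by
    exact_mod_cast fun h => hs ((weightedDegree_eq_zero_iff s).1 h)
  apply mul_left_cancel₀ hw
  rw [← coeff_euler, ← coeff_euler, hA, hB, MvPowerSeries.coeff_mul, MvPowerSeries.coeff_mul]
  refine Finset.sum_congr rfl fun p hp => ?_
  have hp' := Finset.HasAntidiagonal.mem_antidiagonal.1 hp
  have hle : p.2 ≤ s := hp' ▸ le_add_self
  rw [← hlm p.2 hle]
  -- The term with `p.2 = 0` would involve the unknown coefficient at `s` itself, but `l` has no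
  -- constant term. In all other terms `p.1` has smaller degree.
  by_cases hp2 : p.2 = 0
  · rw [hp2]
    simp [hl0]
  · have hlt : weightedDegree p.1 < n := by
      have h1 : weightedDegree p.2 ≠ 0 := fun h => hp2 ((weightedDegree_eq_zero_iff _).1 h)
      rw [← hn, ← hp', map_add]
      omega
    rw [ih _ hlt p.1 (fun v hv => hlm v (hv.trans (hp' ▸ le_self_add))) rfl]

end SeriesLemmas

/-! ### Powers of (1 + X)/(1 - X) in one variable -/

section Univariate

open PowerSeries

/-- The series `X + X ^ 3 + X ^ 5 + ⋯`. -/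
def oddSeries : PowerSeries ℂ := PowerSeries.mk fun n => if Odd n then 1 else 0

theorem one_sub_X_sq_mul_oddSeries : (1 - X ^ 2) * oddSeries = X := by
  ext n
  rw [sub_mul, one_mul, map_sub, mul_comm (X ^ 2), PowerSeries.coeff_mul_X_pow']
  rcases n with _ | _ | n
  · simp [oddSeries]
  · simp [oddSeries]
  · simp [oddSeries, PowerSeries.coeff_X, Nat.odd_add, parity_simps]

/-- The series `(1 + X) / (1 - X)`. -/
def cayley : PowerSeries ℂ := (1 + X) * (1 - X)⁻¹

theorem cayley_mul : cayley * (1 - X) = 1 + X := by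
  rw [cayley, mul_assoc, PowerSeries.inv_mul_cancel _ (by simp), mul_one]

theorem constantCoeff_cayley_sub_one : constantCoeff (cayley - 1) = 0 := by
  simp [cayley]

/-- The power `((1 + X) / (1 - X)) ^ r`. -/
def cayleyPow (r : ℂ) : PowerSeries ℂ :=
  (PowerSeries.exp ℂ).subst (r • (PowerSeries.log ℂ).subst (cayley - 1))

theorem hasSubst_cayley : HasSubst (cayley - 1) :=
  HasSubst.of_constantCoeff_zero' constantCoeff_cayley_sub_one

theorem constantCoeff_smul_log (r : ℂ) :
    constantCoeff (r • (PowerSeries.log ℂ).subst (cayley - 1) : PowerSeries ℂ) = 0 := by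
  have h : constantCoeff ((PowerSeries.log ℂ).subst (cayley - 1) : PowerSeries ℂ) = 0 :=
    constantCoeff_subst_eq_zero constantCoeff_cayley_sub_one _ constantCoeff_log
  rw [PowerSeries.smul_eq_C_mul, map_mul, h, mul_zero]

theorem hasSubst_smul_log (r : ℂ) :
    HasSubst (r • (PowerSeries.log ℂ).subst (cayley - 1) : PowerSeries ℂ) :=
  HasSubst.of_constantCoeff_zero' (constantCoeff_smul_log r)

theorem constantCoeff_cayleyPow (r : ℂ) : constantCoeff (cayleyPow r) = 1 := by
  have h := constantCoeff_subst_eq_zero (constantCoeff_smul_log r) (PowerSeries.exp ℂ - 1)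
    (by simp [constantCoeff_exp])
  rw [subst_sub (hasSubst_smul_log r), map_sub, sub_eq_zero] at h
  have h1 : (1 : PowerSeries ℂ).subst
      (r • (PowerSeries.log ℂ).subst (cayley - 1) : PowerSeries ℂ) = 1 := by
    rw [← coe_substAlgHom (hasSubst_smul_log r), map_one]
  rw [h1] at h
  exact h.trans (by simp)

theorem one_add_X_mul_derivative_log : (1 + X) * d⁄dX ℂ (PowerSeries.log ℂ) = 1 := by
  rw [deriv_log]
  ext n
  rw [add_mul, one_mul, map_add]
  rcases n with _ | n
  · simp
  · rw [PowerSeries.coeff_succ_X_mul]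
    simp [PowerSeries.coeff_one, pow_succ]

/-- This is `(log((1+X)/(1-X)))' = 2/(1-X^2)` with the denominator cleared. -/
theorem derivative_log_cayley :
    (1 - X ^ 2) * d⁄dX ℂ ((PowerSeries.log ℂ).subst (cayley - 1) : PowerSeries ℂ) = 2 := by
  have h1 : cayley * (d⁄dX ℂ (PowerSeries.log ℂ)).subst (cayley - 1) = 1 := by
    have h := congrArg (substAlgHom (R := ℂ) hasSubst_cayley) one_add_X_mul_derivative_log
    rw [map_mul, map_add, map_one, substAlgHom_X, add_sub_cancel] at h
    rw [← coe_substAlgHom hasSubst_cayley]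
    exact h
  have h2 : d⁄dX ℂ cayley * (1 - X) = 1 + cayley := by
    have h := congrArg (d⁄dX ℂ) cayley_mul
    rw [Derivation.leibniz, map_sub, map_add, Derivation.map_one_eq_zero, derivative_X] at h
    simp only [smul_eq_mul] at h
    linear_combination h
  rw [derivative_subst hasSubst_cayley, map_sub, Derivation.map_one_eq_zero, sub_zero]
  have h3 := cayley_mul
  -- With `c = cayley` and `L` the substituted derivative of the logarithm, write `1 + X = c(1-X)`
  -- and use `cL = 1`; what remains is `(1-X)^2 c' = (1-X)(1+c) = (1-X) + (1+X) = 2`.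
  linear_combination (-(1 - X) * (d⁄dX ℂ cayley) *
    (d⁄dX ℂ (PowerSeries.log ℂ)).subst (cayley - 1)) * h3 + (1 - X) ^ 2 * d⁄dX ℂ cayley * h1
    + (1 - X) * h2 + h3

/-- The logarithmic derivative is `2r/(1-X^2)`, and `X/(1-X^2)` is the odd series. -/
theorem X_mul_derivative_cayleyPow (r : ℂ) :
    X * d⁄dX ℂ (cayleyPow r) = C (2 * r) * (cayleyPow r * oddSeries) := by
  have h : (1 - X ^ 2) * d⁄dX ℂ (cayleyPow r) = C (2 * r) * cayleyPow r := by
    rw [cayleyPow, derivative_subst (hasSubst_smul_log r), derivative_exp, Derivation.map_smul,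
      PowerSeries.smul_eq_C_mul (d⁄dX ℂ _), map_mul, map_ofNat]
    linear_combination ((PowerSeries.exp ℂ).subst
      (r • (PowerSeries.log ℂ).subst (cayley - 1) : PowerSeries ℂ)) * C r * derivative_log_cayley
  have hne : (1 - X ^ 2 : PowerSeries ℂ) ≠ 0 := fun h0 => by
    have := congrArg constantCoeff h0
    simp at this
  apply mul_left_cancel₀ hne
  linear_combination X * h - C (2 * r) * cayleyPow r * one_sub_X_sq_mul_oddSeries

end Univariate

/-! ### The factors of the product and their Euler derivatives -/

section ProductSide

theorem hasSubst_t (j : ℕ+) : PowerSeries.HasSubst (t j) := PowerSeries.HasSubst.X j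

theorem subst_cayley (j : ℕ+) : cayley.subst (t j) = (1 + t j) * (1 - t j)⁻¹ := by
  have h : MvPowerSeries.constantCoeff (1 - t j) ≠ 0 := by simp [t]
  rw [MvPowerSeries.eq_mul_inv_iff_mul_eq h]
  have := congrArg (PowerSeries.substAlgHom (R := ℂ) (hasSubst_t j)) cayley_mul
  rw [map_mul, map_add, map_sub, map_one, PowerSeries.substAlgHom_X] at this
  rwa [← PowerSeries.coe_substAlgHom (hasSubst_t j)]

theorem formalPow_eq_subst (j : ℕ+) (r : ℂ) :
    formalPow ((1 + t j) * (1 - t j)⁻¹) r = (cayleyPow r).subst (t j) := by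
  have h1 : (cayley - 1).subst (t j) = (1 + t j) * (1 - t j)⁻¹ - 1 := by
    rw [PowerSeries.subst_sub (hasSubst_t j), subst_cayley]
    congr 1
    rw [← PowerSeries.coe_substAlgHom (hasSubst_t j), map_one]
  rw [formalPow, formalLog, cayleyPow, PowerSeries.subst_comp_subst_apply (hasSubst_smul_log r)
    (hasSubst_t j), PowerSeries.subst_smul (hasSubst_t j),
    PowerSeries.subst_comp_subst_apply hasSubst_cayley (hasSubst_t j), h1]

/-- Both sides multiply the coefficient of `t_j^d` by its weighted degree `d * j`. -/
theorem euler_subst (j : ℕ+) (f : PowerSeries ℂ) :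
    euler (f.subst (t j)) =
      (PowerSeries.C (j : ℂ) * (PowerSeries.X * PowerSeries.derivative ℂ f)).subst (t j) := by
  classical
  ext e
  rw [coeff_euler, t, PowerSeries.coeff_subst_single, PowerSeries.coeff_subst_single]
  split_ifs with h
  · rw [h, weightedDegree_single, PowerSeries.coeff_C_mul]
    simp only [Finsupp.single_eq_same]
    rcases e j with _ | n
    · simp
    · rw [PowerSeries.coeff_succ_X_mul, PowerSeries.coeff_derivative]
      push_cast
      ring
  · simp

/-- The `p`-th factor of the infinite product. -/
def factor (p : ℕ) : Series :=
  formalPow ((1 + t (2 ^ p)) * (1 - t (2 ^ p))⁻¹) (1 / 2 ^ (p + 1))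

/-- The exponent `1/2^(p+1)` is what makes the multiplier `1`: it cancels the degree `2^p` of the
variable and the `2` in the logarithmic derivative. -/
theorem euler_factor (p : ℕ) : euler (factor p) = factor p * oddSeries.subst (t (2 ^ p)) := by
  rw [factor, formalPow_eq_subst, euler_subst, X_mul_derivative_cayleyPow, ← mul_assoc,
    ← map_mul]
  have h : (((2 ^ p : ℕ+) : ℕ) : ℂ) * (2 * (1 / 2 ^ (p + 1))) = 1 := by
    push_cast
    rw [pow_succ]
    field_simp
  rw [h, map_one, one_mul, PowerSeries.subst_mul (hasSubst_t _)]

theorem constantCoeff_factor (p : ℕ) : MvPowerSeries.constantCoeff (factor p) = 1 := by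
  classical
  rw [factor, formalPow_eq_subst, ← MvPowerSeries.coeff_zero_eq_constantCoeff_apply, t,
    PowerSeries.coeff_subst_single]
  simp [constantCoeff_cayleyPow]

end ProductSide

/-! ### The exponential recursion and the infinite product -/

section Recursion

/-- The weighted sum over the transitive commuting pairs on `k` points is `(k - 1)!` times
this monomial. -/
def transMonomial (k : ℕ) : Series := t (2 ^ k.factorization 2) ^ (ordCompl[2] k)

/-- The sequence with `z 0 = 1` and `n * z n = ∑ k ∈ [1, n], transMonomial k * z (n - k)`. -/
def expSeq : ℕ → Series
  | 0 => 1
  | n + 1 => ((n + 1 : ℕ) : ℂ)⁻¹ • ∑ m : Fin (n + 1), transMonomial (m + 1) * expSeq (n - m)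

theorem expSeq_zero : expSeq 0 = 1 := by rw [expSeq]

theorem expSeq_succ (n : ℕ) : ((n + 1 : ℕ) : ℂ) • expSeq (n + 1) =
    ∑ m ∈ Finset.range (n + 1), transMonomial (m + 1) * expSeq (n - m) := by
  rw [expSeq, smul_smul, mul_inv_cancel₀ (Nat.cast_ne_zero.2 n.succ_ne_zero), one_smul, Finset.sum_range]

/-- All monomials in `f` have weighted degree `n`. -/
def IsHomogeneous (n : ℕ) (f : Series) : Prop :=
  ∀ s, weightedDegree s ≠ n → MvPowerSeries.coeff s f = 0

theorem IsHomogeneous.mul {m n : ℕ} {f g : Series} (hf : IsHomogeneous m f)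
    (hg : IsHomogeneous n g) : IsHomogeneous (m + n) (f * g) := by
  classical
  intro s hs
  rw [MvPowerSeries.coeff_mul]
  refine Finset.sum_eq_zero fun p hp => ?_
  have hp' := Finset.HasAntidiagonal.mem_antidiagonal.1 hp
  by_cases h1 : weightedDegree p.1 = m
  · have h2 : weightedDegree p.2 ≠ n := fun h2 => hs (by rw [← hp', map_add, h1, h2])
    rw [hg _ h2, mul_zero]
  · rw [hf _ h1, zero_mul]

theorem coeff_transMonomial {k : ℕ} (s : ℕ+ →₀ ℕ) :
    MvPowerSeries.coeff s (transMonomial k) =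
      if s = Finsupp.single (2 ^ k.factorization 2) (ordCompl[2] k) then 1 else 0 := by
  classical
  rw [transMonomial, t, MvPowerSeries.coeff_X_pow]

theorem isHomogeneous_transMonomial (k : ℕ) : IsHomogeneous k (transMonomial k) := by
  intro s hs
  rw [coeff_transMonomial, if_neg]
  rintro rfl
  apply hs
  rw [weightedDegree_single, mul_comm]
  push_cast
  exact Nat.ordProj_mul_ordCompl_eq_self k 2

theorem isHomogeneous_expSeq (n : ℕ) : IsHomogeneous n (expSeq n) := by
  induction n using Nat.strong_induction_on with
  | _ n ih =>
  rcases n with _ | n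
  · classical
    intro s hs
    rw [expSeq_zero, MvPowerSeries.coeff_one, if_neg]
    rintro rfl
    simp at hs
  · intro s hs
    rw [expSeq, map_smul, map_sum, Finset.sum_eq_zero, smul_zero]
    intro m _
    refine ((isHomogeneous_transMonomial (m + 1)).mul (ih (n - m) (by omega))) s ?_
    have := m.2
    omega

/-- The sum of the homogeneous components `expSeq n`. -/
def totalSeries : Series := fun s => MvPowerSeries.coeff s (expSeq (weightedDegree s))

/-- The sum of all `transMonomial k` with `k ≥ 1`. -/
def transSeries : Series := fun s =>
  if weightedDegree s = 0 then 0 else MvPowerSeries.coeff s (transMonomial (weightedDegree s))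

theorem coeff_totalSeries (s : ℕ+ →₀ ℕ) :
    MvPowerSeries.coeff s totalSeries = MvPowerSeries.coeff s (expSeq (weightedDegree s)) := rfl

theorem coeff_transSeries (s : ℕ+ →₀ ℕ) : MvPowerSeries.coeff s transSeries =
    if weightedDegree s = 0 then 0 else
      MvPowerSeries.coeff s (transMonomial (weightedDegree s)) := rfl

/-- In degree `n` this is the recursion `expSeq_succ`, since there `euler` is multiplication by `n`.
-/
theorem euler_totalSeries : euler totalSeries = totalSeries * transSeries := by
  classical
  ext s
  rw [coeff_euler, coeff_totalSeries]
  rcases hn : weightedDegree s with _ | n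
  · rw [(weightedDegree_eq_zero_iff s).1 hn]
    rw [Nat.cast_zero, zero_mul, MvPowerSeries.coeff_zero_eq_constantCoeff_apply, map_mul,
      ← MvPowerSeries.coeff_zero_eq_constantCoeff_apply transSeries, coeff_transSeries, map_zero,
      if_pos rfl, mul_zero]
  · rw [← smul_eq_mul, ← map_smul, expSeq_succ, map_sum, mul_comm]
    simp_rw [MvPowerSeries.coeff_mul]
    rw [Finset.sum_comm]
    refine Finset.sum_congr rfl fun p hp => ?_
    have hp' := congrArg weightedDegree (Finset.HasAntidiagonal.mem_antidiagonal.1 hp)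
    rw [map_add, hn] at hp'
    rw [coeff_totalSeries, coeff_transSeries]
    -- By homogeneity the degree of `p.1` singles out one summand of the recursion, that of
    -- `transMonomial (k + 1)`; in degree `0` there is none.
    rcases hk : weightedDegree p.1 with _ | k
    · rw [if_pos rfl, zero_mul]
      refine Finset.sum_eq_zero fun m _ => ?_
      rw [isHomogeneous_transMonomial _ _ (by omega), zero_mul]
    · rw [if_neg (by omega), Finset.sum_eq_single k]
      · congr 3
        omega
      · intro m _ hm
        rw [isHomogeneous_transMonomial _ _ (by omega), zero_mul]
      · intro h
        rw [Finset.mem_range] at h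
        omega

theorem hasSum_expSeq : HasSum expSeq totalSeries := by
  -- `formalTopology` is built on the discrete topology of the coefficients, so it must replace the
  -- usual topology of `ℂ` here.
  let _ : TopologicalSpace ℂ := ⊥
  refine (MvPowerSeries.WithPiTopology.hasSum_iff_hasSum_coeff).2 fun s => ?_
  rw [coeff_totalSeries]
  exact hasSum_single _ fun n hn => isHomogeneous_expSeq n s hn.symm

theorem coeff_oddSeries_subst (p : ℕ) (s : ℕ+ →₀ ℕ) :
    MvPowerSeries.coeff s (oddSeries.subst (t (2 ^ p))) =
      if s = Finsupp.single (2 ^ p) (s (2 ^ p)) ∧ Odd (s (2 ^ p)) then 1 else 0 := by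
  classical
  rw [t, PowerSeries.coeff_subst_single]
  by_cases h1 : s = Finsupp.single (2 ^ p) (s (2 ^ p))
  · rw [if_pos h1, oddSeries, PowerSeries.coeff_mk]
    exact if_congr (by rw [and_iff_right h1]) rfl rfl
  · rw [if_neg h1, if_neg fun h => h1 h.1]

theorem factorization_two_pow_mul {p d : ℕ} (hd : Odd d) : (2 ^ p * d).factorization 2 = p := by
  have h0 : d ≠ 0 := by rintro rfl; simp at hd
  rw [Nat.factorization_mul (by positivity) h0, Finsupp.add_apply,
    Nat.factorization_eq_zero_of_not_dvd (n := d) (by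
      rw [← even_iff_two_dvd]; exact Nat.not_even_iff_odd.2 hd)]
  simp [Nat.Prime.factorization_pow Nat.prime_two]

theorem coeff_single_transSeries {p d : ℕ} (hd : Odd d) :
    MvPowerSeries.coeff (Finsupp.single (2 ^ p) d) transSeries = 1 := by
  have h0 : d ≠ 0 := by rintro rfl; simp at hd
  have hw : weightedDegree (Finsupp.single (2 ^ p) d) = 2 ^ p * d := by
    rw [weightedDegree_single, mul_comm]
    push_cast
    rfl
  rw [coeff_transSeries, hw, if_neg (by positivity), coeff_transMonomial,
    factorization_two_pow_mul hd, if_pos]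
  rw [Nat.mul_div_cancel_left _ (by positivity)]

/-- Each `k ≥ 1` is `2^p * d` with `d` odd in exactly one way, so the monomials of `transSeries` are
the `t_(2^p)^d`, each once. Only the `p` whose variable occurs in `s` matter, which allows finite
sums. -/
theorem coeff_transSeries_eq_sum (S : Finset ℕ) (s : ℕ+ →₀ ℕ)
    (hS : ∀ p, s (2 ^ p) ≠ 0 → p ∈ S) :
    MvPowerSeries.coeff s transSeries =
      MvPowerSeries.coeff s (∑ p ∈ S, oddSeries.subst (t (2 ^ p))) := by
  rw [map_sum]
  simp_rw [coeff_oddSeries_subst]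
  by_cases h : ∃ p d, Odd d ∧ s = Finsupp.single (2 ^ p) d
  · obtain ⟨p, d, hd, rfl⟩ := h
    have h0 : d ≠ 0 := by rintro rfl; simp at hd
    have hinj : ∀ q, q ≠ p → (2 ^ p : ℕ+) ≠ 2 ^ q := fun q hq h => hq (by
      have := congrArg (fun j : ℕ+ => (j : ℕ)) h
      push_cast at this
      exact (Nat.pow_right_injective le_rfl this).symm)
    rw [coeff_single_transSeries hd, Finset.sum_eq_single p]
    · simp [hd]
    · intro q _ hq
      simp [Finsupp.single_eq_of_ne (hinj q hq).symm]
    · intro hp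
      exact absurd (hS p (by simpa using h0)) hp
  · rw [Finset.sum_eq_zero, coeff_transSeries, coeff_transMonomial]
    · split_ifs with h1 h2
      · rfl
      · refine absurd ⟨_, _, ?_, h2⟩ h
        rw [← Nat.not_even_iff_odd, even_iff_two_dvd]
        exact Nat.not_dvd_ordCompl Nat.prime_two h1
      · rfl
    · intro p _
      rw [if_neg]
      rintro ⟨h1, h2⟩
      exact h ⟨p, _, h2, h1⟩

theorem hasProd_factor : HasProd factor totalSeries := by
  let _ : TopologicalSpace ℂ := ⊥
  refine (MvPowerSeries.WithPiTopology.tendsto_iff_coeff_tendsto _ _ _).2 fun s => ?_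
  have hinj : Function.Injective fun p : ℕ => (2 ^ p : ℕ+) := fun p q h => by
    have := congrArg (fun j : ℕ+ => (j : ℕ)) h
    push_cast at this
    exact Nat.pow_right_injective le_rfl this
  -- Once a finite product contains every factor whose variable occurs in `s`, its coefficient at
  -- `s` no longer changes.
  let S₀ : Finset ℕ := s.support.preimage (fun p : ℕ => (2 ^ p : ℕ+)) hinj.injOn
  refine tendsto_const_nhds.congr' ?_
  filter_upwards [Filter.eventually_ge_atTop S₀] with S hS
  refine coeff_eq_of_euler_eq euler_totalSeries (euler_prod S _ _ fun p _ => euler_factor p) ?_ ?_ s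
    fun v hv => coeff_transSeries_eq_sum S v fun p hp => hS ?_
  · rw [map_prod, Finset.prod_eq_one fun p _ => constantCoeff_factor p,
      ← MvPowerSeries.coeff_zero_eq_constantCoeff_apply, coeff_totalSeries, map_zero, expSeq_zero]
    simp
  · rw [← MvPowerSeries.coeff_zero_eq_constantCoeff_apply, coeff_transSeries]
    simp
  · rw [Finset.mem_preimage, Finsupp.mem_support_iff]
    have := hv (2 ^ p)
    omega

end Recursion

/-! ### The linear character: independence of choices and conjugation invariance -/

section Phase

variable {α : Type*} {ζ : ℕ → ℂ}

/-- The value of `omega` at `z`, without the proof that `z` lies in the centralizer. -/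
def phaseProduct [Finite α] (ζ : ℕ → ℂ) (x z : Perm α) : ℂ :=
  ∏ q : Cycles x, phase ζ x (z (basePoint x q))

/-- A nowhere vanishing function that `x` multiplies by `ζ i` along each cycle of length `i`. -/
def IsPhase (ζ : ℕ → ℂ) (x : Perm α) (f : α → ℂ) : Prop :=
  ∀ a, f a ≠ 0 ∧ f (x a) = ζ (cycleLength x a) * f a

theorem isPhase_phase [Finite α] (hζ : ∀ i, 0 < i → IsPrimitiveRoot (ζ i) i) (x : Perm α) :
    IsPhase ζ x (phase ζ x) := fun a =>
  ⟨zpow_ne_zero _ (root_ne_zero hζ x a), by simpa using phase_zpow hζ x 1 a⟩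

theorem cycleLength_zpow (x : Perm α) (k : ℤ) (a : α) :
    cycleLength x ((x ^ k) a) = cycleLength x a :=
  cycleLength_apply ((Commute.refl x).zpow_left k) a

theorem IsPhase.apply_zpow [Finite α] (hζ : ∀ i, 0 < i → IsPrimitiveRoot (ζ i) i) {x : Perm α} {f : α → ℂ}
    (hf : IsPhase ζ x f) (k : ℤ) (a : α) :
    f ((x ^ k) a) = ζ (cycleLength x a) ^ k * f a := by
  have h0 := root_ne_zero hζ x a
  induction k using Int.induction_on with
  | zero => simp
  | succ k ih =>
    rw [add_comm, zpow_add, Perm.mul_apply, zpow_one, (hf _).2, cycleLength_zpow, ih,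
      zpow_add₀ h0, zpow_one, mul_assoc]
  | pred k ih =>
    have h1 := (hf ((x ^ (-(k : ℤ) - 1)) a)).2
    rw [← Perm.mul_apply, ← zpow_one_add, cycleLength_zpow, add_sub_cancel, ih] at h1
    rw [zpow_sub₀ h0, zpow_one, div_mul_eq_mul_div, h1, mul_div_cancel_left₀ _ h0]

/-- Moving along a cycle multiplies numerator and denominator by the same power of `ζ i`, because
`z` preserves cycle lengths. Thus the choice of base point is immaterial. -/
theorem IsPhase.ratio_eq [Finite α] (hζ : ∀ i, 0 < i → IsPrimitiveRoot (ζ i) i) {x z : Perm α} {f : α → ℂ}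
    (hf : IsPhase ζ x f) (hz : Commute z x) {a b : α} (h : x.SameCycle a b) :
    f (z a) / f a = f (z b) / f b := by
  obtain ⟨k, rfl⟩ := h
  rw [commute_zpow_apply hz, hf.apply_zpow hζ, hf.apply_zpow hζ, cycleLength_apply hz,
    mul_div_mul_left _ _ (zpow_ne_zero _ (root_ne_zero hζ x a))]

/-- The phases and the base points in `phaseProduct` may be chosen arbitrarily. -/
theorem phaseProduct_eq_prod [Finite α] (hζ : ∀ i, 0 < i → IsPrimitiveRoot (ζ i) i) {x z : Perm α}
    {f : α → ℂ} (hf : IsPhase ζ x f) (hz : Commute z x) {ι : Type*} [Fintype ι] (b : ι → α)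
    (hb : Function.Bijective fun i => cycleOfPoint x (b i)) :
    phaseProduct ζ x z = ∏ i, f (z (b i)) / f (b i) := by
  -- `phase` is `f` rescaled on each cycle so as to equal `1` at the base point.
  have h1 : ∀ a, phase ζ x a = f a / f (basePoint x (cycleOfPoint x a)) := fun a => by
    rw [eq_div_iff (hf _).1]
    have h := hf.apply_zpow hζ (position x a) (basePoint x (cycleOfPoint x a))
    have hl := cycleLength_zpow x (position x a) (basePoint x (cycleOfPoint x a))
    rw [position_spec] at h hl
    rw [h, phase, hl]
  have h2 : phaseProduct ζ x z =
      ∏ q : Cycles x, f (z (basePoint x q)) / f (basePoint x q) := by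
    simp_rw [phaseProduct, h1, ← cycleAction_apply hz]
    -- The rescaling factors belong to the image cycles; `z` permutes the cycles, so their product
    -- may be taken over the original cycles.
    rw [Finset.prod_div_distrib, Finset.prod_div_distrib]
    congr 1
    exact Equiv.prod_comp (cycleAction hz) fun q => f (basePoint x q)
  rw [h2, ← hb.prod_comp]
  exact Finset.prod_congr rfl fun i _ => hf.ratio_eq hζ hz (sameCycle_basePoint x _)

theorem bijective_cycleOfPoint_basePoint (x : Perm α) :
    Function.Bijective fun q : Cycles x => cycleOfPoint x (basePoint x q) := by
  simp_rw [cycleOfPoint_basePoint]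
  exact Function.bijective_id

theorem cycleLength_conj (h x : Perm α) (a : α) :
    cycleLength (h * x * h⁻¹) (h a) = cycleLength x a := by
  apply Nat.dvd_antisymm
  all_goals
    rw [← Int.natCast_dvd_natCast, ← zpow_apply_eq_iff]
  · rw [conj_zpow]
    simpa using (zpow_apply_eq_iff x a _).2 dvd_rfl
  · have := (zpow_apply_eq_iff (h * x * h⁻¹) (h a) _).2 dvd_rfl
    rw [conj_zpow] at this
    simpa using this

/-- Conjugation transports phases and base points; the transported ones need not be the chosen ones,
but `phaseProduct_eq_prod` permits any. -/
theorem phaseProduct_conj [Finite α] (hζ : ∀ i, 0 < i → IsPrimitiveRoot (ζ i) i) {x z : Perm α}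
    (hz : Commute z x) (h : Perm α) :
    phaseProduct ζ (h * x * h⁻¹) (h * z * h⁻¹) = phaseProduct ζ x z := by
  have hf : IsPhase ζ (h * x * h⁻¹) fun a => phase ζ x (h⁻¹ a) := fun a => by
    have h1 := isPhase_phase hζ x (h⁻¹ a)
    refine ⟨h1.1, ?_⟩
    have h2 := cycleLength_conj h x (h⁻¹ a)
    rw [show h (h⁻¹ a) = a by simp] at h2
    rw [h2]
    simpa using h1.2
  rw [phaseProduct_eq_prod hζ hf ((Commute.conj_iff h).2 hz) (fun q : Cycles x => h (basePoint x q)) ?_,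
    phaseProduct_eq_prod hζ (isPhase_phase hζ x) hz _ (bijective_cycleOfPoint_basePoint x)]
  · simp
  · have h3 : ∀ a b, (h * x * h⁻¹).SameCycle (h a) (h b) ↔ x.SameCycle a b := fun a b => by
      rw [sameCycle_conj]
      simp
    constructor
    · intro p q hpq
      rw [cycleOfPoint_eq_iff, h3, ← cycleOfPoint_eq_iff] at hpq
      simpa [cycleOfPoint_basePoint] using hpq
    · intro q
      obtain ⟨c, hc⟩ := h.surjective (basePoint (h * x * h⁻¹) q)
      refine ⟨cycleOfPoint x c, ?_⟩
      rw [← cycleOfPoint_basePoint (h * x * h⁻¹) q, ← hc, cycleOfPoint_eq_iff, h3]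
      exact sameCycle_basePoint x c

end Phase

/-! ### Permutations that preserve a subset and its complement -/

section Decomposition

variable {α : Type*} {ζ : ℕ → ℂ} {p : α → Prop} [DecidablePred p]

theorem subtypeCongr_zpow (x : Perm {a // p a}) (y : Perm {a // ¬p a}) (k : ℤ) :
    x.subtypeCongr y ^ k = (x ^ k).subtypeCongr (y ^ k) :=
  ((Perm.subtypeCongrHom p).map_zpow (x, y) k).symm

theorem subtypeCongr_mul (x x' : Perm {a // p a}) (y y' : Perm {a // ¬p a}) :
    x.subtypeCongr y * x'.subtypeCongr y' = (x * x').subtypeCongr (y * y') :=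
  ((Perm.subtypeCongrHom p).map_mul (x, y) (x', y')).symm

theorem subtypeCongr_inj {x x' : Perm {a // p a}} {y y' : Perm {a // ¬p a}} :
    x.subtypeCongr y = x'.subtypeCongr y' ↔ x = x' ∧ y = y' := by
  have := (Perm.subtypeCongrHom_injective p).eq_iff (a := (x, y)) (b := (x', y'))
  rwa [Prod.mk.injEq] at this

theorem commute_subtypeCongr {x x' : Perm {a // p a}} {y y' : Perm {a // ¬p a}} :
    Commute (x.subtypeCongr y) (x'.subtypeCongr y') ↔ Commute x x' ∧ Commute y y' := by
  rw [Commute, SemiconjBy, subtypeCongr_mul, subtypeCongr_mul, subtypeCongr_inj]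
  rfl

theorem cycleLength_subtypeCongr_left (x : Perm {a // p a}) (y : Perm {a // ¬p a})
    (a : {a // p a}) : cycleLength (x.subtypeCongr y) a = cycleLength x a := by
  apply Nat.dvd_antisymm
  all_goals
    rw [← Int.natCast_dvd_natCast, ← zpow_apply_eq_iff]
  · rw [subtypeCongr_zpow, Perm.subtypeCongr.left_apply_subtype, (zpow_apply_eq_iff x a _).2 dvd_rfl]
  · have := (zpow_apply_eq_iff (x.subtypeCongr y) (a : α) _).2 dvd_rfl
    rw [subtypeCongr_zpow, Perm.subtypeCongr.left_apply_subtype] at this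
    exact Subtype.ext this

theorem cycleLength_subtypeCongr_right (x : Perm {a // p a}) (y : Perm {a // ¬p a})
    (a : {a // ¬p a}) : cycleLength (x.subtypeCongr y) a = cycleLength y a := by
  apply Nat.dvd_antisymm
  all_goals
    rw [← Int.natCast_dvd_natCast, ← zpow_apply_eq_iff]
  · rw [subtypeCongr_zpow, Perm.subtypeCongr.right_apply_subtype,
      (zpow_apply_eq_iff y a _).2 dvd_rfl]
  · have := (zpow_apply_eq_iff (x.subtypeCongr y) (a : α) _).2 dvd_rfl
    rw [subtypeCongr_zpow, Perm.subtypeCongr.right_apply_subtype] at this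
    exact Subtype.ext this

theorem sameCycle_subtypeCongr_left {x : Perm {a // p a}} {y : Perm {a // ¬p a}}
    {a b : {a // p a}} : (x.subtypeCongr y).SameCycle a b ↔ x.SameCycle a b := by
  simp_rw [SameCycle, subtypeCongr_zpow, Perm.subtypeCongr.left_apply_subtype, Subtype.ext_iff]

theorem sameCycle_subtypeCongr_right {x : Perm {a // p a}} {y : Perm {a // ¬p a}}
    {a b : {a // ¬p a}} : (x.subtypeCongr y).SameCycle a b ↔ y.SameCycle a b := by
  simp_rw [SameCycle, subtypeCongr_zpow, Perm.subtypeCongr.right_apply_subtype, Subtype.ext_iff]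

theorem not_sameCycle_subtypeCongr {x : Perm {a // p a}} {y : Perm {a // ¬p a}}
    (a : {a // p a}) (b : {a // ¬p a}) : ¬(x.subtypeCongr y).SameCycle a b := by
  rintro ⟨k, hk⟩
  rw [subtypeCongr_zpow, Perm.subtypeCongr.left_apply_subtype] at hk
  exact b.2 (hk ▸ ((x ^ k) a).2)

/-- The phases of the two pieces glue to a phase on `α`, and the base points of the two pieces
together meet each cycle once. -/
theorem phaseProduct_subtypeCongr [Finite α] (hζ : ∀ i, 0 < i → IsPrimitiveRoot (ζ i) i)
    {x z : Perm {a // p a}} {y w : Perm {a // ¬p a}} (hx : Commute z x) (hy : Commute w y) :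
    phaseProduct ζ (x.subtypeCongr y) (z.subtypeCongr w) =
      phaseProduct ζ x z * phaseProduct ζ y w := by
  let f : α → ℂ := fun a => if h : p a then phase ζ x ⟨a, h⟩ else phase ζ y ⟨a, h⟩
  have hfl : ∀ a : {a // p a}, f a = phase ζ x a := fun a => dif_pos a.2
  have hfr : ∀ a : {a // ¬p a}, f a = phase ζ y a := fun a => dif_neg a.2
  have hf : IsPhase ζ (x.subtypeCongr y) f := fun a => by
    by_cases h : p a
    · lift a to {a // p a} using h
      rw [cycleLength_subtypeCongr_left, Perm.subtypeCongr.left_apply_subtype, hfl, hfl]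
      exact isPhase_phase hζ x a
    · lift a to {a // ¬p a} using h
      rw [cycleLength_subtypeCongr_right, Perm.subtypeCongr.right_apply_subtype, hfr, hfr]
      exact isPhase_phase hζ y a
  rw [phaseProduct_eq_prod hζ hf (commute_subtypeCongr.2 ⟨hx, hy⟩)
    (Sum.elim (fun q : Cycles x => Subtype.val (basePoint x q))
      fun q : Cycles y => Subtype.val (basePoint y q)) ?_,
    phaseProduct_eq_prod hζ (isPhase_phase hζ x) hx _ (bijective_cycleOfPoint_basePoint x),
    phaseProduct_eq_prod hζ (isPhase_phase hζ y) hy _ (bijective_cycleOfPoint_basePoint y),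
    Fintype.prod_sum_type]
  · simp only [Sum.elim_inl, Sum.elim_inr, Perm.subtypeCongr.left_apply_subtype,
      Perm.subtypeCongr.right_apply_subtype, hfl, hfr]
  · constructor
    · rintro (q | q) (r | r) h <;> rw [cycleOfPoint_eq_iff] at h
      · rw [Sum.elim_inl, Sum.elim_inl, sameCycle_subtypeCongr_left, ← cycleOfPoint_eq_iff] at h
        simpa [cycleOfPoint_basePoint] using h
      · exact absurd h (not_sameCycle_subtypeCongr _ _)
      · exact absurd h.symm (not_sameCycle_subtypeCongr _ _)
      · rw [Sum.elim_inr, Sum.elim_inr, sameCycle_subtypeCongr_right, ← cycleOfPoint_eq_iff] at h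
        simpa [cycleOfPoint_basePoint] using h
    · intro q
      rw [← cycleOfPoint_basePoint _ q]
      generalize basePoint _ q = a
      by_cases h : p a
      · lift a to {a // p a} using h
        exact ⟨Sum.inl (cycleOfPoint x a), (cycleOfPoint_eq_iff _).2
          (sameCycle_subtypeCongr_left.2 (sameCycle_basePoint x a))⟩
      · lift a to {a // ¬p a} using h
        exact ⟨Sum.inr (cycleOfPoint y a), (cycleOfPoint_eq_iff _).2
          (sameCycle_subtypeCongr_right.2 (sameCycle_basePoint y a))⟩

end Decomposition

/-! ### Cycle type monomials -/

section TypeMonomial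

variable {α : Type*} [Fintype α] [DecidableEq α]

/-- The indeterminate attached to a part of a partition. -/
def partVar (j : ℕ) : Series := if h : 0 < j then t ⟨j, h⟩ else 1

/-- The monomial of the cycle type of `g`, fixed points included. -/
def typeMonomial (g : Perm α) : Series := (g.partition.parts.map partVar).prod

theorem typeMonomial_eq (g : Perm α) : typeMonomial g =
    (g.cycleType.map partVar).prod * partVar 1 ^ (Fintype.card α - g.support.card) := by
  simp [typeMonomial, parts_partition]

theorem cycleType_subtypeCongr {p : α → Prop} [DecidablePred p] (x : Perm {a // p a})
    (y : Perm {a // ¬p a}) : (x.subtypeCongr y).cycleType = x.cycleType + y.cycleType := by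
  have h : x.subtypeCongr y = ofSubtype x * ofSubtype y := by
    ext a
    by_cases h : p a
    · rw [Perm.subtypeCongr.left_apply _ _ h, Perm.mul_apply,
        ofSubtype_apply_of_not_mem y (not_not.2 h), ofSubtype_apply_of_mem x h]
    · rw [Perm.subtypeCongr.right_apply _ _ h, Perm.mul_apply, ofSubtype_apply_of_mem y h,
        ofSubtype_apply_of_not_mem x (y ⟨a, h⟩).2]
  have hd : Disjoint (ofSubtype x) (ofSubtype y) := fun a => by
    by_cases h : p a
    · exact Or.inr (ofSubtype_apply_of_not_mem y (not_not.2 h))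
    · exact Or.inl (ofSubtype_apply_of_not_mem x h)
  rw [h, hd.cycleType_mul, cycleType_ofSubtype, cycleType_ofSubtype]

theorem typeMonomial_subtypeCongr {p : α → Prop} [DecidablePred p] (x : Perm {a // p a})
    (y : Perm {a // ¬p a}) : typeMonomial (x.subtypeCongr y) = typeMonomial x * typeMonomial y := by
  have hx := x.support.card_le_univ
  have hy := y.support.card_le_univ
  have hc := Fintype.card_subtype_compl p
  have hc' := Fintype.card_subtype_le p
  rw [typeMonomial_eq, typeMonomial_eq, typeMonomial_eq, ← sum_cycleType, cycleType_subtypeCongr,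
    Multiset.map_add, Multiset.prod_add, Multiset.sum_add, sum_cycleType, sum_cycleType,
    show Fintype.card α - (x.support.card + y.support.card) =
      (Fintype.card {a // p a} - x.support.card) + (Fintype.card {a // ¬p a} - y.support.card)
      by omega, pow_add]
  ring

theorem cycleLength_eq_card_support_cycleOf {g : Perm α} {a : α} (h : a ∈ g.support) :
    cycleLength g a = (g.cycleOf a).support.card := by
  have hc : (g.cycleOf a).IsCycle := isCycle_cycleOf g (mem_support.1 h)
  rw [← hc.orderOf]
  apply Nat.dvd_antisymm
  · rw [← Int.natCast_dvd_natCast, ← zpow_apply_eq_iff, ← cycleOf_zpow_apply_self,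
      zpow_natCast, pow_orderOf_eq_one, Perm.one_apply]
  · rw [orderOf_dvd_iff_pow_eq_one, hc.pow_eq_one_iff]
    refine ⟨a, ?_, ?_⟩
    · rwa [cycleOf_apply_self, ← mem_support]
    · have := (zpow_apply_eq_iff g a (cycleLength g a)).2 dvd_rfl
      rwa [← cycleOf_zpow_apply_self, zpow_natCast] at this

/-- This links the cycle type, built from nontrivial cycle factors and fixed points, to the minimal
periods used in `cycleLength`. -/
theorem mem_parts_partition_iff {g : Perm α} {j : ℕ} :
    j ∈ g.partition.parts ↔ ∃ a, cycleLength g a = j := by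
  have hfix : ∀ a, a ∉ g.support → cycleLength g a = 1 := fun a ha => by
    rw [← Nat.dvd_one, ← Int.natCast_dvd_natCast, ← zpow_apply_eq_iff]
    simpa using ha
  rw [parts_partition, Multiset.mem_add, Multiset.mem_replicate]
  constructor
  · rintro (h | ⟨h, rfl⟩)
    · rw [cycleType_def, Multiset.mem_map] at h
      obtain ⟨c, hc, rfl⟩ := h
      have hc' : c ∈ g.cycleFactorsFinset := hc
      obtain ⟨a, ha⟩ := (mem_cycleFactorsFinset_iff.1 hc').1.nonempty_support
      have := cycle_is_cycleOf ha hc'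
      refine ⟨a, ?_⟩
      rw [cycleLength_eq_card_support_cycleOf (mem_cycleFactorsFinset_support_le hc' ha), ← this]
      rfl
    · obtain ⟨a, ha⟩ : ∃ a, a ∉ g.support := by
        by_contra! h'
        exact h (by rw [Finset.eq_univ_of_forall h', Finset.card_univ, Nat.sub_self])
      exact ⟨a, hfix a ha⟩
  · rintro ⟨a, rfl⟩
    by_cases ha : a ∈ g.support
    · left
      rw [cycleLength_eq_card_support_cycleOf ha, cycleType_def, Multiset.mem_map]
      exact ⟨g.cycleOf a, cycleOf_mem_cycleFactorsFinset_iff.2 ha, rfl⟩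
    · right
      refine ⟨?_, hfix a ha⟩
      have := Finset.card_lt_univ_of_notMem ha
      omega

theorem parts_eq_replicate {g : Perm α} {m : ℕ} (h : ∀ a, cycleLength g a = m) :
    g.partition.parts = Multiset.replicate g.partition.parts.card m :=
  Multiset.eq_replicate_card.2 fun j hj => by
    obtain ⟨a, rfl⟩ := mem_parts_partition_iff.1 hj
    exact h a

theorem card_eq_mul_of_forall_cycleLength {g : Perm α} {m : ℕ} (h : ∀ a, cycleLength g a = m) :
    Fintype.card α = g.partition.parts.card * m := by
  have h2 := g.partition.parts_sum.symm
  rwa [parts_eq_replicate h, Multiset.sum_replicate, smul_eq_mul] at h2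

/-- The monomial of a permutation whose cycles all have length `m`. -/
theorem typeMonomial_of_forall_cycleLength {g : Perm α} {m : ℕ} (h : ∀ a, cycleLength g a = m)
    (hm : 0 < m) : typeMonomial g = partVar m ^ (Fintype.card α / m) := by
  rw [typeMonomial, parts_eq_replicate h, Multiset.map_replicate, Multiset.prod_replicate,
    Nat.div_eq_of_eq_mul_left hm (card_eq_mul_of_forall_cycleLength h)]

end TypeMonomial

/-! ### The exponential formula for commuting pairs -/

section PairSum

open Classical in
/-- The contribution of the pair `(y, g)`, which vanishes unless `g` commutes with `y` and all
cycles of `y` have odd length. -/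
def pairWeight {α : Type*} [Fintype α] [DecidableEq α] (ζ : ℕ → ℂ) (y g : Perm α) : Series :=
  if Commute g y ∧ ∀ a, Odd (cycleLength y a) then phaseProduct ζ y g • typeMonomial g else 0

/-- `b` can be reached from `a` by powers of `y` and `g`. -/
def Reaches {α : Type*} (q : Perm α × Perm α) (a b : α) : Prop :=
  ∃ m n : ℤ, b = (q.1 ^ m) ((q.2 ^ n) a)

/-- The sum of the contributions of all pairs. -/
def pairSum (α : Type*) [Fintype α] [DecidableEq α] (ζ : ℕ → ℂ) : Series :=
  ∑ q : Perm α × Perm α, pairWeight ζ q.1 q.2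

open Classical in
/-- The sum of the contributions of the transitive pairs. -/
def transSum {α : Type*} [Fintype α] [DecidableEq α] (ζ : ℕ → ℂ) (a : α) : Series :=
  ∑ q : Perm α × Perm α with ∀ b, Reaches q a b, pairWeight ζ q.1 q.2

theorem reaches_zpow {α : Type*} {q : Perm α × Perm α} (hq : Commute q.2 q.1) {a b : α}
    (h : Reaches q a b) (k l : ℤ) : Reaches q a ((q.1 ^ k) ((q.2 ^ l) b)) := by
  obtain ⟨m, n, rfl⟩ := h
  refine ⟨k + m, l + n, ?_⟩
  have := congrArg (fun f : Perm α => f ((q.2 ^ n) a)) ((hq.zpow_zpow l m).eq)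
  simp only [Perm.mul_apply] at this
  rw [this, zpow_add, zpow_add, Perm.mul_apply, Perm.mul_apply]

variable {α : Type*} [Fintype α] [DecidableEq α] {ζ : ℕ → ℂ}

theorem pairWeight_subtypeCongr (hζ : ∀ i, 0 < i → IsPrimitiveRoot (ζ i) i) {p : α → Prop}
    [DecidablePred p] (y g : Perm {a // p a}) (y' g' : Perm {a // ¬p a}) :
    pairWeight ζ (y.subtypeCongr y') (g.subtypeCongr g') =
      pairWeight ζ y g * pairWeight ζ y' g' := by
  have h : (Commute (g.subtypeCongr g') (y.subtypeCongr y') ∧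
      ∀ a, Odd (cycleLength (y.subtypeCongr y') a)) ↔
      (Commute g y ∧ ∀ a, Odd (cycleLength y a)) ∧
        (Commute g' y' ∧ ∀ a, Odd (cycleLength y' a)) := by
    rw [commute_subtypeCongr]
    constructor
    · rintro ⟨⟨h1, h2⟩, h3⟩
      exact ⟨⟨h1, fun a => cycleLength_subtypeCongr_left y y' a ▸ h3 a⟩,
        ⟨h2, fun a => cycleLength_subtypeCongr_right y y' a ▸ h3 a⟩⟩
    · rintro ⟨⟨h1, h2⟩, h3, h4⟩
      refine ⟨⟨h1, h3⟩, fun a => ?_⟩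
      by_cases ha : p a
      · exact (cycleLength_subtypeCongr_left y y' ⟨a, ha⟩).symm ▸ h2 ⟨a, ha⟩
      · exact (cycleLength_subtypeCongr_right y y' ⟨a, ha⟩).symm ▸ h4 ⟨a, ha⟩
  unfold pairWeight
  by_cases h1 : Commute g y ∧ ∀ a, Odd (cycleLength y a)
  · by_cases h2 : Commute g' y' ∧ ∀ a, Odd (cycleLength y' a)
    · rw [if_pos (h.2 ⟨h1, h2⟩), if_pos h1, if_pos h2, typeMonomial_subtypeCongr,
        phaseProduct_subtypeCongr hζ h1.1 h2.1, smul_mul_smul_comm]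
    · rw [if_neg fun h3 => h2 (h.1 h3).2, if_neg h2, mul_zero]
  · rw [if_neg fun h3 => h1 (h.1 h3).1, if_neg h1, zero_mul]

open Classical in
/-- The pairs such that the orbit of `a` is the set of all points with `p` are made up of a
transitive pair on this set and a pair on its complement. -/
theorem sum_orbit_eq (hζ : ∀ i, 0 < i → IsPrimitiveRoot (ζ i) i) (p : α → Prop)
    [DecidablePred p] (a : α) (ha : p a) :
    ∑ q : Perm α × Perm α with ∀ b, Reaches q a b ↔ p b, pairWeight ζ q.1 q.2 =
      transSum ζ (⟨a, ha⟩ : {b // p b}) * pairSum {b // ¬p b} ζ := by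
  rw [transSum, pairSum, Finset.sum_mul_sum, ← Finset.sum_product']
  symm
  refine Finset.sum_of_injOn
    (fun r => (r.1.1.subtypeCongr r.2.1, r.1.2.subtypeCongr r.2.2)) ?_ ?_ ?_ ?_
  · rintro ⟨⟨y, g⟩, y', g'⟩ _ ⟨⟨x, h⟩, x', h'⟩ _ heq
    simp only [Prod.mk.injEq, subtypeCongr_inj] at heq ⊢
    tauto
  · rintro ⟨⟨y, g⟩, y', g'⟩ hr
    simp only [Finset.coe_product, Set.mem_prod, Finset.mem_coe, Finset.mem_filter,
      Finset.mem_univ, true_and, and_true] at hr ⊢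
    have h1 : ∀ m n : ℤ, ((y.subtypeCongr y') ^ m) (((g.subtypeCongr g') ^ n) a) =
        ((y ^ m) ((g ^ n) ⟨a, ha⟩) : {b // p b}) := fun m n => by
      rw [subtypeCongr_zpow, subtypeCongr_zpow, Perm.subtypeCongr.left_apply _ _ ha,
        Perm.subtypeCongr.left_apply_subtype]
    intro b
    constructor
    · rintro ⟨m, n, rfl⟩
      simp only [h1]
      exact Subtype.prop _
    · intro hb
      obtain ⟨m, n, hmn⟩ := hr ⟨b, hb⟩
      exact ⟨m, n, by simp only [h1]; rw [← hmn]⟩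
  · rintro ⟨y, g⟩ hq hq'
    rw [Finset.mem_filter] at hq
    rw [pairWeight, if_neg]
    rintro ⟨hc, -⟩
    apply hq'
    -- A pair with nonzero weight commutes, so the orbit of `a` is stable under both permutations,
    -- and they restrict to it and to its complement.
    have h1 : ∀ (k l : ℤ) (b : α), p b → p ((y ^ k) ((g ^ l) b)) := fun k l b hb =>
      (hq.2 _).1 (reaches_zpow (q := (y, g)) hc ((hq.2 b).2 hb) k l)
    have hy : ∀ b, p (y b) ↔ p b := fun b =>
      ⟨fun h => by simpa using h1 (-1) 0 _ h, fun h => by simpa using h1 1 0 _ h⟩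
    have hg : ∀ b, p (g b) ↔ p b := fun b =>
      ⟨fun h => by simpa using h1 0 (-1) _ h, fun h => by simpa using h1 0 1 _ h⟩
    have h2 : ∀ (x : Perm α) (hx : ∀ b, p (x b) ↔ p b), (x.subtypePerm hx).subtypeCongr
        (x.subtypePerm (p := fun b => ¬p b) fun b => not_congr (hx b)) = x := fun x hx => by
      ext b
      rw [Perm.subtypeCongr.apply]
      split_ifs <;> rfl
    refine ⟨((y.subtypePerm hy, g.subtypePerm hg),
      (y.subtypePerm (p := fun b => ¬p b) fun b => not_congr (hy b),
        g.subtypePerm (p := fun b => ¬p b) fun b => not_congr (hg b))), ?_, ?_⟩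
    · simp only [Finset.coe_product, Set.mem_prod, Finset.mem_coe, Finset.mem_filter,
        Finset.mem_univ, true_and, and_true]
      rintro ⟨b, hb⟩
      obtain ⟨m, n, hmn⟩ := (hq.2 b).2 hb
      exact ⟨m, n, Subtype.ext (by simpa using hmn)⟩
    · simp only [h2]
  · rintro ⟨⟨y, g⟩, y', g'⟩ _
    exact (pairWeight_subtypeCongr hζ y g y' g').symm

/-- The pairs are sorted by the orbit of `a`, recorded as the set `S` of its other points. -/
theorem pairSum_eq_sum_powerset (hζ : ∀ i, 0 < i → IsPrimitiveRoot (ζ i) i) (a : α) :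
    pairSum α ζ = ∑ S ∈ (Finset.univ.erase a).powerset,
      transSum ζ (⟨a, Or.inl rfl⟩ : {b // b = a ∨ b ∈ S}) * pairSum {b // ¬(b = a ∨ b ∈ S)} ζ := by
  classical
  have hmap : ∀ q ∈ (Finset.univ : Finset (Perm α × Perm α)),
      ({b | Reaches q a b} : Finset α).erase a ∈ (Finset.univ.erase a).powerset := fun q _ => by
    rw [Finset.mem_powerset]
    exact Finset.erase_subset_erase _ (Finset.subset_univ _)
  rw [pairSum, ← Finset.sum_fiberwise_of_maps_to hmap]
  refine Finset.sum_congr rfl fun S hS => ?_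
  rw [← sum_orbit_eq hζ (fun b => b = a ∨ b ∈ S) a]
  refine Finset.sum_congr (Finset.filter_congr fun q _ => ?_) fun _ _ => rfl
  have haS : a ∉ S := fun h => by
    simpa using Finset.mem_powerset.1 hS h
  have haa : Reaches q a a := ⟨0, 0, by simp⟩
  rw [Finset.ext_iff]
  refine forall_congr' fun b => ?_
  rw [Finset.mem_erase, Finset.mem_filter]
  by_cases hb : b = a
  · subst hb
    simp [haS, haa]
  · simp [hb]

theorem pairSum_of_isEmpty [IsEmpty α] : pairSum α ζ = 1 := by
  have : IsEmpty (Cycles (1 : Perm α)) := ⟨fun q => isEmptyElim (basePoint _ q)⟩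
  rw [pairSum, Finset.sum_eq_single_of_mem (1, 1) (Finset.mem_univ _) fun q _ hq =>
    absurd (Subsingleton.elim _ _) hq, pairWeight, if_pos ⟨Subsingleton.elim _ _, isEmptyElim⟩,
    phaseProduct, typeMonomial_eq, Finset.prod_of_isEmpty, one_smul]
  simp

open Nat in
/-- The exponential formula for commuting pairs. -/
theorem pairSum_eq {α : Type u} [Fintype α] [DecidableEq α]
    (hζ : ∀ i, 0 < i → IsPrimitiveRoot (ζ i) i)
    (htrans : ∀ (β : Type u) [Fintype β] [DecidableEq β] (a : β), transSum ζ a =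
      ((Fintype.card β - 1)! : ℂ) • transMonomial (Fintype.card β)) {n : ℕ}
    (hn : Fintype.card α = n) : pairSum α ζ = (n ! : ℂ) • expSeq n := by
  induction n using Nat.strong_induction_on generalizing α with
  | _ n ih =>
  rcases n with _ | n
  · have := Fintype.card_eq_zero_iff.1 hn
    rw [pairSum_of_isEmpty, expSeq_zero, factorial_zero, Nat.cast_one, one_smul]
  · obtain ⟨a⟩ : Nonempty α := Fintype.card_pos_iff.1 (by omega)
    have hcard : (Finset.univ.erase a).card = n := by
      rw [Finset.card_erase_of_mem (Finset.mem_univ a), Finset.card_univ, hn,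
        Nat.add_sub_cancel]
    rw [pairSum_eq_sum_powerset hζ a]
    trans ∑ S ∈ (Finset.univ.erase a).powerset,
      ((S.card ! * (n - S.card)! : ℕ) : ℂ) • (transMonomial (S.card + 1) * expSeq (n - S.card))
    · refine Finset.sum_congr rfl fun S hS => ?_
      have hS' := Finset.mem_powerset.1 hS
      have haS : a ∉ S := fun h => by simpa using hS' h
      have h1 : Fintype.card {b // b = a ∨ b ∈ S} = S.card + 1 := by
        rw [← Finset.card_insert_of_notMem haS, Fintype.card_subtype]
        congr 1
        ext b
        simp
      have h2 : Fintype.card {b // ¬(b = a ∨ b ∈ S)} = n - S.card := by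
        rw [Fintype.card_subtype_compl, h1, hn, Nat.add_sub_add_right]
      rw [htrans, ih (n - S.card) (by omega) h2, h1, smul_mul_smul_comm, Nat.add_sub_cancel,
        Nat.cast_mul]
    -- The summand depends only on `m = |S|`. The `n.choose m` sets turn `m! (n-m)!` into `n!`, and
    -- the remaining factor `n + 1` of `(n+1)!` is the one in `expSeq_succ`.
    · rw [Finset.sum_powerset_apply_card (fun m => ((m ! * (n - m)! : ℕ) : ℂ) •
        (transMonomial (m + 1) * expSeq (n - m))), hcard, factorial_succ, mul_comm, Nat.cast_mul,
        mul_smul, expSeq_succ, Finset.smul_sum]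
      refine Finset.sum_congr rfl fun m hm => ?_
      rw [← Nat.cast_smul_eq_nsmul ℂ, smul_smul, ← Nat.cast_mul, ← mul_assoc,
        Nat.choose_mul_factorial_mul_factorial (Finset.mem_range_succ_iff.1 hm)]

end PairSum

/-! ### Sums of roots of unity and Möbius inversion -/

section RootSums

theorem orderOf_pow_val {i : ℕ} [NeZero i] {ξ : ℂ} (hξ : IsPrimitiveRoot ξ i) (j : ZMod i) :
    orderOf (ξ ^ j.val) = addOrderOf j := by
  refine Nat.dvd_right_iff_eq.1 fun n => ?_
  rw [orderOf_dvd_iff_pow_eq_one, ← pow_mul, hξ.pow_eq_one_iff_dvd,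
    addOrderOf_dvd_iff_nsmul_eq_zero, ← ZMod.natCast_eq_zero_iff, Nat.cast_mul,
    ZMod.natCast_zmod_val, nsmul_eq_mul, mul_comm]

theorem sum_zmod_eq_sum_nthRoots {M : Type*} [AddCommMonoid M] {i : ℕ} [NeZero i] {ξ : ℂ}
    (hξ : IsPrimitiveRoot ξ i) (f : ℂ → ℕ → M) :
    ∑ j : ZMod i, f (ξ ^ j.val) (addOrderOf j) =
      ∑ η ∈ Polynomial.nthRootsFinset i (1 : ℂ), f η (orderOf η) := by
  have hi : 0 < i := Nat.pos_of_ne_zero (NeZero.ne i)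
  refine Finset.sum_bij (fun j _ => ξ ^ j.val) (fun j _ => ?_) (fun j _ k _ h => ?_)
    (fun η hη => ?_) fun j _ => by rw [orderOf_pow_val hξ]
  · rw [Polynomial.mem_nthRootsFinset hi, ← pow_mul, mul_comm, pow_mul, hξ.pow_eq_one, one_pow]
  · exact ZMod.val_injective i (hξ.pow_inj (ZMod.val_lt j) (ZMod.val_lt k) h)
  · rw [Polynomial.mem_nthRootsFinset hi] at hη
    obtain ⟨n, hn, rfl⟩ := hξ.eq_pow_of_pow_eq_one hη
    exact ⟨n, Finset.mem_univ _, by rw [ZMod.val_natCast_of_lt hn]⟩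

theorem sum_nthRoots_eq_sum_divisors {M : Type*} [AddCommMonoid M] (i : ℕ) (f : ℂ → ℕ → M) :
    ∑ η ∈ Polynomial.nthRootsFinset i (1 : ℂ), f η (orderOf η) =
      ∑ e ∈ i.divisors, ∑ η ∈ primitiveRoots e ℂ, f η e := by
  classical
  rw [IsPrimitiveRoot.nthRoots_one_eq_biUnion_primitiveRoots,
    Finset.sum_biUnion fun a _ b _ hab => IsPrimitiveRoot.disjoint hab]
  refine Finset.sum_congr rfl fun e he => Finset.sum_congr rfl fun η hη => ?_
  rw [← ((mem_primitiveRoots (Nat.pos_of_mem_divisors he)).1 hη).eq_orderOf]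

/-- The sum of the primitive `e`-th roots of unity, as a constant series. -/
def rootSum : ArithmeticFunction Series :=
  ⟨fun e => MvPowerSeries.C (∑ η ∈ primitiveRoots e ℂ, η), by simp⟩

theorem rootSum_apply (e : ℕ) :
    rootSum e = MvPowerSeries.C (∑ η ∈ primitiveRoots e ℂ, η) := rfl

/-- Summing over the divisors of `n` gives the sum of all `n`-th roots of unity, which vanishes
unless `n = 1`. So `rootSum` is the Möbius function. -/
theorem rootSum_mul_zeta : rootSum * (ArithmeticFunction.zeta : ArithmeticFunction Series) = 1 := by
  ext1 n
  rw [ArithmeticFunction.coe_mul_zeta_apply]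
  simp_rw [rootSum_apply]
  rw [← map_sum, ← sum_nthRoots_eq_sum_divisors n fun η _ => η]
  rcases Nat.eq_zero_or_pos n with rfl | hn
  · simp
  have : NeZero n := ⟨hn.ne'⟩
  have hξ := Complex.isPrimitiveRoot_exp n hn.ne'
  rw [← sum_zmod_eq_sum_nthRoots hξ fun η _ => η]
  obtain rfl | h1 := Nat.eq_or_lt_of_le (Nat.succ_le_of_lt hn)
  · simp
  · rw [ArithmeticFunction.one_apply_ne (by omega)]
    rw [Finset.sum_bij (t := Finset.range n)
      (g := fun a => Complex.exp (2 * Real.pi * Complex.I / n) ^ a)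
      (fun (j : ZMod n) _ => j.val) (fun j _ => Finset.mem_range.2 (ZMod.val_lt j))
      (fun j _ k _ h => ZMod.val_injective n h)
      (fun a ha => ⟨a, Finset.mem_univ _, ZMod.val_natCast_of_lt (Finset.mem_range.1 ha)⟩)
      fun _ _ => rfl, hξ.geom_sum_eq_zero h1, map_zero]

theorem transMonomial_eq {k : ℕ} (hk : k ≠ 0) :
    transMonomial k = partVar (k / ordCompl[2] k) ^ ordCompl[2] k := by
  have h1 : k / ordCompl[2] k = 2 ^ k.factorization 2 :=
    Nat.div_div_self (Nat.ordProj_dvd k 2) hk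
  rw [h1, transMonomial, partVar, dif_pos (by positivity)]
  congr 2

/-- For `i = e * d` the monomial depends only on `d`, so the inner sum is a Dirichlet convolution
with the Möbius function. The odd divisors of `k` are the divisors of its odd part, and Möbius
inversion keeps only the term of the odd part itself. -/
theorem sum_rootSum_eq {k : ℕ} (hk : k ≠ 0) :
    ∑ i ∈ k.divisors with Odd i, ∑ e ∈ i.divisors,
      rootSum e * partVar (k / i * e) ^ (k / (k / i * e)) = transMonomial k := by
  have hK0 : ordCompl[2] k ≠ 0 := (Nat.ordCompl_pos 2 hk).ne'
  have hKk : ordCompl[2] k ∣ k := Nat.ordCompl_dvd k 2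
  have hdiv : {i ∈ k.divisors | Odd i} = (ordCompl[2] k).divisors := by
    ext i
    rw [Finset.mem_filter, Nat.mem_divisors, Nat.mem_divisors]
    constructor
    · rintro ⟨⟨h, -⟩, ho⟩
      refine ⟨Nat.Coprime.dvd_of_dvd_mul_left (Nat.Coprime.pow_right (k.factorization 2)
        (Nat.coprime_two_right.2 ho)) ?_, hK0⟩
      rwa [Nat.ordProj_mul_ordCompl_eq_self]
    · rintro ⟨h, -⟩
      refine ⟨⟨h.trans hKk, hk⟩, Nat.not_even_iff_odd.1 fun he => ?_⟩
      exact Nat.not_dvd_ordCompl Nat.prime_two hk ((even_iff_two_dvd.1 he).trans h)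
  -- The monomial as a function of `d = i / e`; the value at `0` is forced by the definition of an
  -- arithmetic function.
  let G : ArithmeticFunction Series :=
    ⟨fun d => if d = 0 then 0 else partVar (k / d) ^ d, if_pos rfl⟩
  have hG : ∀ d, d ≠ 0 → G d = partVar (k / d) ^ d := fun d hd => if_neg hd
  have h := congrArg (fun f : ArithmeticFunction Series => f (ordCompl[2] k))
    (congrArg (G * ·) rootSum_mul_zeta)
  simp only [mul_one] at h
  rw [hG _ hK0, ← transMonomial_eq hk, ← mul_assoc, ArithmeticFunction.coe_mul_zeta_apply] at h
  rw [hdiv, ← h]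
  refine Finset.sum_congr rfl fun i hi => ?_
  have hik : i ∣ k := (Nat.dvd_of_mem_divisors hi).trans hKk
  rw [ArithmeticFunction.mul_apply, Nat.sum_divisorsAntidiagonal' fun d e => G d * rootSum e]
  refine Finset.sum_congr rfl fun e he => ?_
  obtain ⟨d, rfl⟩ := Nat.dvd_of_mem_divisors he
  obtain ⟨c, rfl⟩ := hik
  have he0 : 0 < e := Nat.pos_of_ne_zero (by rintro rfl; simp at hk)
  have hd0 : 0 < d := Nat.pos_of_ne_zero (by rintro rfl; simp at hk)
  have hc0 : 0 < c := Nat.pos_of_ne_zero (by rintro rfl; simp at hk)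
  rw [Nat.mul_div_cancel_left _ (Nat.mul_pos he0 hd0), Nat.mul_div_cancel_left _ he0, hG _ hd0.ne',
    mul_comm, show e * d * c = d * (c * e) by ring, Nat.mul_div_cancel _ (Nat.mul_pos hc0 he0),
    Nat.mul_div_cancel_left _ hd0]

/-- Grouping the shifts `j` by their additive order `e` makes `ζ i ^ j` run over the primitive
`e`-th roots of unity. -/
theorem sum_zmod_eq_transMonomial {ζ : ℕ → ℂ} (hζ : ∀ i, 0 < i → IsPrimitiveRoot (ζ i) i) {k : ℕ}
    (hk : k ≠ 0) (F : ℕ → Series) (hF : ∀ i [NeZero i], i ∣ k → Odd i → F i = ∑ j : ZMod i,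
      ζ i ^ j.val • partVar (k / i * addOrderOf j) ^ (k / (k / i * addOrderOf j))) :
    ∑ i ∈ k.divisors with Odd i, F i = transMonomial k := by
  rw [← sum_rootSum_eq hk]
  refine Finset.sum_congr rfl fun i hi => ?_
  have hik := Nat.dvd_of_mem_divisors (Finset.mem_filter.1 hi).1
  have hi0 : 0 < i := Nat.pos_of_dvd_of_pos hik (Nat.pos_of_ne_zero hk)
  have : NeZero i := ⟨hi0.ne'⟩
  rw [hF i hik (Finset.mem_filter.1 hi).2, sum_zmod_eq_sum_nthRoots (hζ i hi0) fun η e =>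
    η • partVar (k / i * e) ^ (k / (k / i * e)), sum_nthRoots_eq_sum_divisors i fun η e =>
    η • partVar (k / i * e) ^ (k / (k / i * e))]
  refine Finset.sum_congr rfl fun e _ => ?_
  rw [← Finset.sum_smul, rootSum_apply, MvPowerSeries.smul_eq_C_mul]

end RootSums

/-! ### Normal form of transitive commuting pairs -/

section NormalForm

open Fin.NatCast

variable {β : Type*} {m i : ℕ} {ζ : ℕ → ℂ}

theorem pow_apply_eq_iff (x : Perm β) (b : β) (n : ℕ) :
    (x ^ n) b = b ↔ cycleLength x b ∣ n := by
  rw [← Int.natCast_dvd_natCast, ← zpow_apply_eq_iff, zpow_natCast]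

theorem pow_val_apply (x : Perm β) (b : β) (hb : cycleLength x b = i) (n : ℕ) :
    (x ^ (n : ZMod i).val) b = (x ^ n) b := by
  rw [ZMod.val_natCast, ← hb, Perm.coe_pow, Perm.coe_pow]
  exact Function.iterate_mod_minimalPeriod_eq

theorem cycleLength_eq_of_forall {x : Perm β} {b : β} {l : ℕ}
    (h : ∀ n : ℕ, (x ^ n) b = b ↔ l ∣ n) : cycleLength x b = l :=
  Nat.dvd_right_iff_eq.1 fun n => by rw [← pow_apply_eq_iff, h]

/-- The permutations `y` and `g` are, in the coordinates `e`, the translation of each row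
`{r} × ZMod i` by `1` and the translation to the next row, with a shift by `j` when passing from
the last row to the first one. -/
structure IsNormalForm (e : Fin (m + 1) × ZMod i ≃ β) (j : ZMod i) (y g : Perm β) : Prop where
  fst_apply : ∀ r s, y (e (r, s)) = e (r, s + 1)
  snd_apply : ∀ r s, g (e (r, s)) = e (r + 1, s + if r = Fin.last m then j else 0)

/-- The pair with normal form `j` in the coordinates `e`. -/
def normalPair (j : ZMod i) (e : Fin (m + 1) × ZMod i ≃ β) : Perm β × Perm β :=
  (e.permCongr (Equiv.prodShear (Equiv.refl _) fun _ => Equiv.addRight 1),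
    e.permCongr (Equiv.prodShear (Equiv.addRight 1) fun r =>
      Equiv.addRight (if r = Fin.last m then j else 0)))

theorem isNormalForm_normalPair (j : ZMod i) (e : Fin (m + 1) × ZMod i ≃ β) :
    IsNormalForm e j (normalPair j e).1 (normalPair j e).2 :=
  ⟨fun r s => by simp [normalPair, Equiv.prodShear], fun r s => by
    simp [normalPair, Equiv.prodShear]⟩

namespace IsNormalForm

variable {e : Fin (m + 1) × ZMod i ≃ β} {j : ZMod i} {y g : Perm β}

theorem eq_normalPair (h : IsNormalForm e j y g) : normalPair j e = (y, g) := by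
  have h' := isNormalForm_normalPair j e
  refine Prod.ext (Equiv.ext fun b => ?_) (Equiv.ext fun b => ?_) <;>
    obtain ⟨⟨r, s⟩, rfl⟩ := e.surjective b
  · rw [h'.fst_apply, h.fst_apply]
  · rw [h'.snd_apply, h.snd_apply]

theorem commute (h : IsNormalForm e j y g) : Commute g y := by
  ext b
  obtain ⟨⟨r, s⟩, rfl⟩ := e.surjective b
  rw [Perm.mul_apply, Perm.mul_apply, h.fst_apply, h.snd_apply, h.snd_apply, h.fst_apply,
    add_right_comm]

theorem fst_pow_apply (h : IsNormalForm e j y g) (n : ℕ) (r : Fin (m + 1)) (s : ZMod i) :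
    (y ^ n) (e (r, s)) = e (r, s + n) := by
  induction n with
  | zero => simp
  | succ n ih => rw [pow_succ', Perm.mul_apply, ih, h.fst_apply, Nat.cast_succ, add_assoc]

/-- The quotient counts the passages from the last row to the first, each of which adds `j`. -/
theorem snd_pow_apply (h : IsNormalForm e j y g) (n : ℕ) :
    (g ^ n) (e (0, 0)) = e ((n : Fin (m + 1)), (n / (m + 1)) • j) := by
  induction n with
  | zero => simp
  | succ n ih =>
    rw [pow_succ', Perm.mul_apply, ih, h.snd_apply, Nat.cast_succ, Nat.succ_div, add_smul]
    congr 3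
    have h1 : (n : Fin (m + 1)) = Fin.last m ↔ m + 1 ∣ n + 1 := by
      rw [← Fin.natCast_eq_zero, Nat.cast_succ]
      constructor
      · intro h2
        rw [h2, Fin.last_add_one]
      · intro h2
        rw [← add_left_inj 1, h2, Fin.last_add_one]
    simp only [h1]
    split_ifs <;> simp

theorem pow_pow_apply (h : IsNormalForm e j y g) [NeZero i] (r : Fin (m + 1)) (s : ZMod i) :
    (y ^ s.val) ((g ^ r.val) (e (0, 0))) = e (r, s) := by
  rw [h.snd_pow_apply, h.fst_pow_apply, Nat.div_eq_of_lt r.2]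
  simp

theorem reaches (h : IsNormalForm e j y g) [NeZero i] (b : β) : Reaches (y, g) (e (0, 0)) b := by
  obtain ⟨⟨r, s⟩, rfl⟩ := e.surjective b
  exact ⟨s.val, r.val, by rw [zpow_natCast, zpow_natCast, h.pow_pow_apply]⟩

theorem cycleLength_fst (h : IsNormalForm e j y g) (b : β) : cycleLength y b = i := by
  obtain ⟨⟨r, s⟩, rfl⟩ := e.surjective b
  refine cycleLength_eq_of_forall fun n => ?_
  rw [h.fst_pow_apply, e.apply_eq_iff_eq, Prod.mk.injEq, and_iff_right rfl, add_eq_left,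
    ZMod.natCast_eq_zero_iff]

/-- `g` is back in the first row after each `m + 1` steps, having shifted it by `j`. By transitivity
all cycles of `g` have the same length. -/
theorem cycleLength_snd (h : IsNormalForm e j y g) [NeZero i] (b : β) :
    cycleLength g b = (m + 1) * addOrderOf j := by
  have h1 : cycleLength g b = cycleLength g (e (0, 0)) := by
    obtain ⟨k, l, rfl⟩ := h.reaches b
    rw [cycleLength_apply (h.commute.symm.zpow_left k), cycleLength_zpow]
  rw [h1]
  refine cycleLength_eq_of_forall fun n => ?_
  rw [h.snd_pow_apply, e.apply_eq_iff_eq, Prod.mk.injEq, Fin.natCast_eq_zero,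
    ← addOrderOf_dvd_iff_nsmul_eq_zero]
  constructor
  · rintro ⟨h2, h3⟩
    rw [← Nat.mul_div_cancel' h2]
    exact mul_dvd_mul_left _ h3
  · intro h2
    exact ⟨(dvd_mul_right _ _).trans h2, Nat.dvd_div_of_mul_dvd h2⟩

/-- With phase `ζ i ^ s` and base points `(r, 0)`, only the passage out of the last row has a ratio
other than `1`. -/
theorem phaseProduct_eq (hζ : ∀ i, 0 < i → IsPrimitiveRoot (ζ i) i) [Finite β]
    (h : IsNormalForm e j y g) [NeZero i] : phaseProduct ζ y g = ζ i ^ j.val := by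
  have hξ := hζ i (Nat.pos_of_ne_zero (NeZero.ne i))
  have h0 : ζ i ≠ 0 := hξ.ne_zero (NeZero.ne i)
  have hadd : ∀ s t : ZMod i, ζ i ^ (s + t).val = ζ i ^ s.val * ζ i ^ t.val := fun s t => by
    rw [ZMod.val_add, ← pow_add]
    conv_rhs => rw [← Nat.mod_add_div (s.val + t.val) i, pow_add, pow_mul, hξ.pow_eq_one, one_pow,
      mul_one]
  -- For `i = 1` the residue `1` has representative `0`, so this also needs `ζ i ^ i = 1`.
  have hone : ζ i ^ (1 : ZMod i).val = ζ i := by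
    rw [ZMod.val_one_eq_one_mod]
    conv_rhs => rw [← pow_one (ζ i), ← Nat.mod_add_div 1 i, pow_add, pow_mul, hξ.pow_eq_one,
      one_pow, mul_one]
  have hf : IsPhase ζ y fun b => ζ i ^ (e.symm b).2.val := fun b => by
    refine ⟨pow_ne_zero _ h0, ?_⟩
    rw [h.cycleLength_fst]
    obtain ⟨⟨r, s⟩, rfl⟩ := e.surjective b
    simp only [h.fst_apply, e.symm_apply_apply]
    rw [hadd, hone, mul_comm]
  have hb : Function.Bijective fun r : Fin (m + 1) => cycleOfPoint y (e (r, 0)) := by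
    constructor
    · intro r r' hr
      obtain ⟨k, hk⟩ := (cycleOfPoint_eq_iff y).1 hr
      obtain ⟨n, hn⟩ := mem_powers_iff_mem_zpowers.2 (⟨k, rfl⟩ : y ^ k ∈ Subgroup.zpowers y)
      simp only at hn
      rw [← hn, h.fst_pow_apply, e.apply_eq_iff_eq, Prod.mk.injEq] at hk
      exact hk.1
    · intro q
      obtain ⟨⟨r, s⟩, hr⟩ := e.surjective (basePoint y q)
      refine ⟨r, ?_⟩
      rw [← cycleOfPoint_basePoint y q, ← hr, cycleOfPoint_eq_iff]
      exact ⟨s.val, by rw [zpow_natCast, h.fst_pow_apply]; simp⟩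
  rw [phaseProduct_eq_prod hζ hf h.commute _ hb, Finset.prod_eq_single (Fin.last m)]
  · rw [h.snd_apply]
    simp
  · intro r _ hr
    rw [h.snd_apply, if_neg hr]
    simp
  · simp

theorem pairWeight_eq (hζ : ∀ i, 0 < i → IsPrimitiveRoot (ζ i) i) [Fintype β] [DecidableEq β]
    (h : IsNormalForm e j y g) [NeZero i] (hi : Odd i) :
    pairWeight ζ y g = ζ i ^ j.val • partVar ((m + 1) * addOrderOf j) ^
      (Fintype.card β / ((m + 1) * addOrderOf j)) := by
  rw [pairWeight, if_pos ⟨h.commute, fun b => by rwa [h.cycleLength_fst]⟩, h.phaseProduct_eq hζ,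
    typeMonomial_of_forall_cycleLength h.cycleLength_snd
      (Nat.mul_pos m.succ_pos (addOrderOf_pos j))]

end IsNormalForm

/-- Every transitive commuting pair has a normal form. -/
theorem exists_isNormalForm [Fintype β] [NeZero i] {y g : Perm β} (hc : Commute g y) {a : β}
    (ha : ∀ b, Reaches (y, g) a b) (hi : cycleLength y a = i)
    (hcard : Fintype.card β = (m + 1) * i) :
    ∃ (j : ZMod i) (e : Fin (m + 1) × ZMod i ≃ β), e (0, 0) = a ∧ IsNormalForm e j y g := by
  have hpow : ∀ (x : Perm β) (k : ℤ), ∃ n : ℕ, x ^ n = x ^ k := fun x k =>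
    mem_powers_iff_mem_zpowers.2 (⟨k, rfl⟩ : x ^ k ∈ Subgroup.zpowers x)
  have hlen : ∀ b, cycleLength y b = i := fun b => by
    obtain ⟨k, l, rfl⟩ := ha b
    rw [cycleLength_zpow, cycleLength_apply (hc.zpow_left l), hi]
  have hcomm : ∀ (k l : ℕ) (b : β), (g ^ l) ((y ^ k) b) = (y ^ k) ((g ^ l) b) := fun k l b =>
    congrArg (fun f : Perm β => f b) (hc.pow_pow l k).eq
  have hact : ∀ n : ℕ, (cycleAction hc ^ n) (cycleOfPoint y a) = cycleOfPoint y ((g ^ n) a) := by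
    intro n
    induction n with
    | zero => simp
    | succ n ih =>
      rw [pow_succ', pow_succ', Perm.mul_apply, Perm.mul_apply, ih]
      rfl
  -- `k` is the number of steps after which `g` first returns to the `y`-cycle of `a`, and `J` below
  -- is the shift along that cycle.
  have hk : ∃ k, k = cycleLength (cycleAction hc) (cycleOfPoint y a) := ⟨_, rfl⟩
  obtain ⟨k, hk⟩ := hk
  have hk0 : 0 < k := hk ▸ cycleLength_pos _ _
  have hkdvd : ∀ n : ℕ, cycleOfPoint y ((g ^ n) a) = cycleOfPoint y a ↔ k ∣ n := fun n => by
    rw [← hact, pow_apply_eq_iff, hk]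
  obtain ⟨J, hJ⟩ : ∃ J : ℕ, (y ^ J) a = (g ^ k) a := by
    obtain ⟨l, hl⟩ := (cycleOfPoint_eq_iff y).1 ((hkdvd k).2 dvd_rfl).symm
    obtain ⟨J, hJ⟩ := hpow y l
    exact ⟨J, by rw [hJ, hl]⟩
  have hJq : ∀ q : ℕ, (g ^ (k * q)) a = (y ^ (J * q)) a := fun q => by
    induction q with
    | zero => simp
    | succ q ih =>
      rw [mul_add, mul_one, pow_add, Perm.mul_apply, ← hJ, hcomm, ih, ← Perm.mul_apply, ← pow_add,
        mul_add, mul_one, add_comm]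
  have hinj : Function.Injective fun p : Fin k × ZMod i => (y ^ p.2.val) ((g ^ p.1.val) a) := by
    have hle : ∀ (r r' : Fin k) (s s' : ZMod i), r ≤ r' →
        (y ^ s.val) ((g ^ r.val) a) = (y ^ s'.val) ((g ^ r'.val) a) → r = r' := by
      intro r r' s s' hr heq
      have h1 : cycleOfPoint y ((g ^ (r'.val - r.val)) a) = cycleOfPoint y a := by
        rw [cycleOfPoint_eq_iff]
        refine ⟨(s'.val : ℤ) - s.val, (g ^ r.val).injective ?_⟩
        rw [← zpow_natCast g, commute_zpow_apply (hc.zpow_left r.val), zpow_natCast,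
          ← Perm.mul_apply (g ^ r.val), ← pow_add, Nat.add_sub_cancel' hr, sub_eq_neg_add, zpow_add,
          Perm.mul_apply, zpow_natCast, ← heq, zpow_neg, zpow_natCast, Perm.inv_eq_iff_eq]
      have h2 := Nat.eq_zero_of_dvd_of_lt ((hkdvd _).1 h1) (by omega)
      exact Fin.ext (by omega)
    rintro ⟨r, s⟩ ⟨r', s'⟩ heq
    have hr : r = r' := by
      rcases le_total r r' with h | h
      · exact hle r r' s s' h heq
      · exact (hle r' r s' s h heq.symm).symm
    subst hr
    refine Prod.ext rfl (ZMod.val_injective i ?_)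
    simp only [Perm.coe_pow] at heq
    refine Function.iterate_injOn_Iio_minimalPeriod ?_ ?_ heq
    all_goals
      rw [Set.mem_Iio]
      exact (ZMod.val_lt _).trans_eq (hlen _).symm
  have hsurj : Function.Surjective
      fun p : Fin k × ZMod i => (y ^ p.2.val) ((g ^ p.1.val) a) := fun b => by
    obtain ⟨M, N, rfl⟩ := ha b
    obtain ⟨M, hM⟩ := hpow y M
    obtain ⟨N, hN⟩ := hpow g N
    -- The `N / k` full turns in `g ^ N` act on `a` as `y ^ (J * (N / k))`.
    refine ⟨(⟨N % k, Nat.mod_lt N hk0⟩, (M + J * (N / k) : ℕ)), ?_⟩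
    simp only
    rw [pow_val_apply y _ (hlen _), ← hM, ← hN, pow_add, Perm.mul_apply, ← hcomm, ← hJq,
      ← Perm.mul_apply (g ^ (N % k)), ← pow_add, Nat.mod_add_div]
  have hbij : Function.Bijective
      fun p : Fin k × ZMod i => (y ^ p.2.val) ((g ^ p.1.val) a) := ⟨hinj, hsurj⟩
  have hkm : k = m + 1 := by
    have h1 := Fintype.card_of_bijective hbij
    rw [Fintype.card_prod, Fintype.card_fin, ZMod.card, hcard] at h1
    exact Nat.eq_of_mul_eq_mul_right (Nat.pos_of_ne_zero (NeZero.ne i)) h1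
  subst hkm
  obtain ⟨e, he⟩ : ∃ e : Fin (m + 1) × ZMod i ≃ β,
      ∀ r s, e (r, s) = (y ^ s.val) ((g ^ r.val) a) :=
    ⟨Equiv.ofBijective _ hbij, fun _ _ => rfl⟩
  refine ⟨J, e, by simp [he], ⟨fun r s => ?_, fun r s => ?_⟩⟩ <;> rw [he, he]
  · have h1 : s + 1 = ((s.val + 1 : ℕ) : ZMod i) := by simp
    rw [h1, pow_val_apply y _ (hlen _), pow_succ', Perm.mul_apply]
  · have h1 := hcomm s.val 1 ((g ^ r.val) a)
    rw [pow_one] at h1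
    rw [h1, ← Perm.mul_apply g, ← pow_succ']
    split_ifs with hr
    · subst hr
      have h2 : s + (J : ZMod i) = ((s.val + J : ℕ) : ZMod i) := by simp
      rw [h2, pow_val_apply y _ (hlen _), Fin.last_add_one, pow_add y, Perm.mul_apply,
        Fin.val_zero, pow_zero, Perm.one_apply, hJ, Fin.val_last]
    · rw [Fin.val_add_one, if_neg hr, add_zero]

end NormalForm

/-! ### The sum over transitive pairs -/

section Transitive

open Nat in
theorem card_equiv_apply_eq {M β : Type*} [Fintype M] [Fintype β] [DecidableEq M] [DecidableEq β]
    (h : Fintype.card M = Fintype.card β) (x : M) (a : β) :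
    Fintype.card {e : M ≃ β // e x = a} = (Fintype.card β - 1)! := by
  have h1 : ∀ b, Fintype.card {e : M ≃ β // e x = b} = Fintype.card {e : M ≃ β // e x = a} :=
    fun b => Fintype.card_congr
      -- Composing with a transposition matches the fibres over `a` and `b`, so all bijections are
      -- shared equally among the values at `x`.
      { toFun := fun e => ⟨e.1.trans (swap a b), by simp [e.2]⟩
        invFun := fun e => ⟨e.1.trans (swap a b), by simp [e.2]⟩
        left_inv := fun e => Subtype.ext (Equiv.ext fun y => by simp)
        right_inv := fun e => Subtype.ext (Equiv.ext fun y => by simp) }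
  have h2 := Fintype.card_congr (Equiv.sigmaFiberEquiv fun e : M ≃ β => e x)
  rw [Fintype.card_sigma, Fintype.card_equiv (Fintype.equivOfCardEq h), h] at h2
  simp_rw [h1] at h2
  have hpos : 0 < Fintype.card β := Fintype.card_pos_iff.2 ⟨a⟩
  rw [Finset.sum_const, Finset.card_univ, smul_eq_mul, ← Nat.mul_factorial_pred hpos.ne'] at h2
  exact Nat.eq_of_mul_eq_mul_left hpos h2

variable {β : Type*} [Fintype β] [DecidableEq β] {ζ : ℕ → ℂ}

-- The pairs correspond to a shift `j` and coordinates that send the origin to `a`; there are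
-- `(k-1)!` such coordinates on `k` points.
open Classical Nat in
theorem sum_transitive_of_cycleLength (hζ : ∀ i, 0 < i → IsPrimitiveRoot (ζ i) i) (a : β) (i : ℕ)
    [NeZero i] (hik : i ∣ Fintype.card β) (hi : Odd i) :
    ∑ q : Perm β × Perm β with
        ((∀ b, Reaches q a b) ∧ Commute q.2 q.1) ∧ cycleLength q.1 a = i,
      pairWeight ζ q.1 q.2 =
    ((Fintype.card β - 1)! : ℂ) • ∑ j : ZMod i,
      ζ i ^ j.val • partVar (Fintype.card β / i * addOrderOf j) ^
        (Fintype.card β / (Fintype.card β / i * addOrderOf j)) := by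
  obtain ⟨c, hc⟩ := hik
  have hi0 : 0 < i := Nat.pos_of_ne_zero (NeZero.ne i)
  have hpos : 0 < Fintype.card β := Fintype.card_pos_iff.2 ⟨a⟩
  obtain ⟨m, rfl⟩ : ∃ m, c = m + 1 := Nat.exists_eq_succ_of_ne_zero (by rintro rfl; omega)
  have hdiv : Fintype.card β / i = m + 1 := by rw [hc, Nat.mul_div_cancel_left _ hi0]
  have hcard : Fintype.card (Fin (m + 1) × ZMod i) = Fintype.card β := by
    rw [Fintype.card_prod, Fintype.card_fin, ZMod.card, hc, mul_comm]
  rw [hdiv, ← card_equiv_apply_eq hcard (0, 0) a, Nat.cast_smul_eq_nsmul, ← Finset.card_univ,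
    ← Finset.sum_const, ← Finset.sum_product']
  symm
  refine Finset.sum_bij (fun p _ => normalPair p.2 p.1.1) ?_ ?_ ?_ ?_
  · rintro ⟨⟨e, rfl⟩, j⟩ -
    have h := isNormalForm_normalPair j e
    rw [Finset.mem_filter]
    exact ⟨Finset.mem_univ _, ⟨h.reaches, h.commute⟩, h.cycleLength_fst _⟩
  · rintro ⟨⟨e, he⟩, j⟩ - ⟨⟨e', he'⟩, j'⟩ - heq
    have h := isNormalForm_normalPair j e
    have h' := isNormalForm_normalPair j' e'
    simp only at heq
    rw [← heq] at h'
    -- The coordinates are recovered from the pair: `(r, s)` is the point `y ^ s (g ^ r a)`.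
    have hee : e = e' := Equiv.ext fun p => by
      rw [← h.pow_pow_apply, ← h'.pow_pow_apply, he, he']
    subst hee
    have h1 := h.snd_apply (Fin.last m) 0
    rw [h'.snd_apply, if_pos rfl, if_pos rfl, e.apply_eq_iff_eq, zero_add, zero_add,
      Prod.mk.injEq] at h1
    rw [h1.2]
  · rintro ⟨y, g⟩ hq
    rw [Finset.mem_filter] at hq
    obtain ⟨j, e, he, h⟩ := exists_isNormalForm hq.2.1.2 hq.2.1.1 hq.2.2
      (hc.trans (mul_comm _ _))
    exact ⟨(⟨e, he⟩, j), Finset.mem_product.2 ⟨Finset.mem_univ _, Finset.mem_univ _⟩,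
      h.eq_normalPair⟩
  · rintro ⟨⟨e, he⟩, j⟩ -
    exact ((isNormalForm_normalPair j e).pairWeight_eq hζ hi).symm

-- Sort by the length `i` of the `y`-cycle of `a`. Transitivity and commutation give every cycle of
-- `y` this length, so `i` divides the number of points.
open Nat in
theorem transSum_eq (hζ : ∀ i, 0 < i → IsPrimitiveRoot (ζ i) i) (a : β) :
    transSum ζ a = ((Fintype.card β - 1)! : ℂ) • transMonomial (Fintype.card β) := by
  classical
  have hk : Fintype.card β ≠ 0 := (Fintype.card_pos_iff.2 ⟨a⟩).ne'
  have hfac : ((Fintype.card β - 1)! : ℂ) ≠ 0 := Nat.cast_ne_zero.2 (Nat.factorial_ne_zero _)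
  let s : Finset (Perm β × Perm β) := {q | (∀ b, Reaches q a b) ∧ Commute q.2 q.1}
  have h1 : transSum ζ a = ∑ q ∈ s with Odd (cycleLength q.1 a), pairWeight ζ q.1 q.2 := by
    symm
    refine Finset.sum_subset (fun q hq => ?_) fun q hq hq' => ?_
    · simp only [s, Finset.mem_filter] at hq ⊢
      exact ⟨hq.1.1, hq.1.2.1⟩
    · rw [pairWeight, if_neg]
      rintro ⟨h2, h3⟩
      simp only [s, Finset.mem_filter] at hq hq'
      exact hq' ⟨⟨hq.1, hq.2, h2⟩, h3 a⟩
  have hmap : ∀ q ∈ {q ∈ s | Odd (cycleLength q.1 a)},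
      cycleLength q.1 a ∈ {i ∈ (Fintype.card β).divisors | Odd i} := fun q hq => by
    simp only [s, Finset.mem_filter] at hq ⊢
    refine ⟨Nat.mem_divisors.2 ⟨?_, hk⟩, hq.2⟩
    rw [card_eq_mul_of_forall_cycleLength (g := q.1) (m := cycleLength q.1 a)]
    · exact dvd_mul_left _ _
    · intro b
      obtain ⟨k, l, rfl⟩ := hq.1.2.1 b
      rw [cycleLength_zpow, cycleLength_apply (hq.1.2.2.zpow_left l)]
  have h2 : ∀ i, Odd i → ({q ∈ ({q ∈ s | Odd (cycleLength q.1 a)} : Finset (Perm β × Perm β)) |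
        cycleLength q.1 a = i} : Finset (Perm β × Perm β)) =
      ({q | ((∀ b, Reaches q a b) ∧ Commute q.2 q.1) ∧ cycleLength q.1 a = i} :
        Finset (Perm β × Perm β)) := fun i hi => by
    ext q
    simp only [s, Finset.mem_filter, Finset.mem_univ, true_and]
    constructor
    · rintro ⟨⟨h3, -⟩, h4⟩
      exact ⟨h3, h4⟩
    · rintro ⟨h3, h4⟩
      exact ⟨⟨h3, h4.symm ▸ hi⟩, h4⟩
  rw [h1, ← Finset.sum_fiberwise_of_maps_to hmap, ← sum_zmod_eq_transMonomial hζ hk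
    (fun i => ((Fintype.card β - 1)! : ℂ)⁻¹ •
      ∑ q ∈ {q ∈ s | Odd (cycleLength q.1 a)} with cycleLength q.1 a = i, pairWeight ζ q.1 q.2),
    ← Finset.smul_sum, smul_inv_smul₀ hfac]
  intro i _ hik hi
  rw [h2 i hi, sum_transitive_of_cycleLength hζ a i hik hi, inv_smul_smul₀ hfac]

end Transitive

/-! ### From higher Lie characters to commuting pairs -/

section ClassSums

theorem sum_conj_eq {G M : Type*} [Group G] [Fintype G] [AddCommMonoid M] [Module ℂ M] (x : G)
    [DecidablePred (IsConj x)] (φ : G → M) :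
    ∑ a : G, φ (a * x * a⁻¹) =
      (Nat.card (Subgroup.centralizer ({x} : Set G)) : ℂ) • ∑ y with IsConj x y, φ y := by
  classical
  rw [← Finset.sum_fiberwise_of_maps_to (t := {y | IsConj x y}) (g := fun a => a * x * a⁻¹)
    (fun a _ => by
      rw [Finset.mem_filter]
      exact ⟨Finset.mem_univ _, isConj_iff.2 ⟨a, rfl⟩⟩), Finset.smul_sum]
  refine Finset.sum_congr rfl fun y hy => ?_
  obtain ⟨b, rfl⟩ := isConj_iff.1 (Finset.mem_filter.1 hy).2
  -- The elements that conjugate `x` to a given conjugate form a left coset of the centralizer.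
  have hcard : ({a | a * x * a⁻¹ = b * x * b⁻¹} : Finset G).card =
      Nat.card (Subgroup.centralizer ({x} : Set G)) := by
    rw [Nat.card_eq_fintype_card, Fintype.card_subtype]
    refine Finset.card_bij (fun a _ => b⁻¹ * a) (fun a ha => ?_) (fun _ _ _ _ h => by simpa using h)
      fun z hz => ⟨b * z, ?_, by simp⟩
    · simp only [Finset.mem_filter, Finset.mem_univ, true_and,
        Subgroup.mem_centralizer_singleton_iff] at ha ⊢
      calc b⁻¹ * a * x = b⁻¹ * (a * x * a⁻¹) * a := by group
        _ = x * (b⁻¹ * a) := by rw [ha]; group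
    · simp only [Finset.mem_filter, Finset.mem_univ, true_and,
        Subgroup.mem_centralizer_singleton_iff] at hz ⊢
      calc b * z * x * (b * z)⁻¹ = b * (z * x) * z⁻¹ * b⁻¹ := by group
        _ = b * x * b⁻¹ := by rw [hz]; group
  rw [Finset.sum_congr rfl (g := fun _ => φ (b * x * b⁻¹)) fun a ha => by
    rw [(Finset.mem_filter.1 ha).2], Finset.sum_const, hcard, Nat.cast_smul_eq_nsmul]

variable {n : ℕ} {ζ : ℕ → ℂ}

/-- The cycle type as a partition of `n`. -/
def typePartition (x : Perm (Fin n)) : n.Partition where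
  parts := x.partition.parts
  parts_pos h := x.partition.parts_pos h
  parts_sum := x.partition.parts_sum.trans (Fintype.card_fin n)

theorem typePartition_eq_iff {x : Perm (Fin n)} {μ : n.Partition} :
    typePartition x = μ ↔ HasCycleType x μ := Nat.Partition.ext_iff

theorem typePartition_representative (μ : n.Partition) :
    typePartition (representative μ) = μ :=
  typePartition_eq_iff.2 (hasCycleType_representative μ)

theorem isConj_iff_typePartition_eq {x y : Perm (Fin n)} :
    IsConj x y ↔ typePartition x = typePartition y := by
  rw [partition_eq_of_isConj, Nat.Partition.ext_iff, Nat.Partition.ext_iff]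
  rfl

theorem isConj_representative_iff {μ : n.Partition} {y : Perm (Fin n)} :
    IsConj (representative μ) y ↔ typePartition y = μ := by
  rw [isConj_iff_typePartition_eq, typePartition_representative, eq_comm]

theorem typePartition_mem_odds_iff {y : Perm (Fin n)} :
    typePartition y ∈ Nat.Partition.odds n ↔ ∀ a, Odd (cycleLength y a) := by
  simp only [Nat.Partition.odds, Nat.Partition.restricted, Finset.mem_filter, Finset.mem_univ,
    true_and, Nat.not_even_iff_odd]
  constructor
  · exact fun h a => h _ (mem_parts_partition_iff.2 ⟨a, rfl⟩)
  · intro h j hj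
    obtain ⟨a, rfl⟩ := mem_parts_partition_iff.1 hj
    exact h a

theorem typeMonomial_eq_tMonomial (g : Perm (Fin n)) :
    typeMonomial g = tMonomial (typePartition g) := by
  classical
  have h1 : typeMonomial g = ((typePartition g).parts.map partVar).prod := rfl
  rw [h1, tMonomial, Finset.prod_multiset_map_count]
  generalize typePartition g = ν
  rw [Finset.prod_subset (s₂ := (Finset.range n).image (· + 1)), Finset.prod_image]
  · refine Finset.prod_congr rfl fun j _ => ?_
    rw [partVar, dif_pos j.succ_pos]
    rfl
  · exact fun _ _ _ _ h => Nat.succ_injective h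
  · intro j hj
    have hj' := Multiset.mem_toFinset.1 hj
    have h2 := ν.parts_pos hj'
    have h3 := Multiset.le_sum_of_mem hj'
    rw [ν.parts_sum] at h3
    exact Finset.mem_image.2 ⟨j - 1, Finset.mem_range.2 (by omega), by omega⟩
  · intro j _ hj
    rw [Multiset.count_eq_zero_of_notMem fun h => hj (Multiset.mem_toFinset.2 h), pow_zero]

open Classical in
/-- The higher Lie character as a sum over the conjugates of `x` that commute with `g`. -/
theorem psiPerm_eq_sum (hζ : ∀ i, 0 < i → IsPrimitiveRoot (ζ i) i) (x g : Perm (Fin n)) :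
    psiPerm hζ x g =
      ∑ y with IsConj x y, if Commute g y then phaseProduct ζ y g else 0 := by
  have h0 : (Nat.card (Subgroup.centralizer ({x} : Set (Perm (Fin n)))) : ℂ) ≠ 0 :=
    Nat.cast_ne_zero.2 Nat.card_pos.ne'
  rw [psiPerm, inducedChar, inv_mul_eq_iff_eq_mul₀ h0, ← smul_eq_mul, ← sum_conj_eq]
  refine Finset.sum_congr rfl fun a _ => ?_
  have h1 : a⁻¹ * g * a ∈ Subgroup.centralizer ({x} : Set (Perm (Fin n))) ↔
      Commute g (a * x * a⁻¹) := by
    rw [Subgroup.mem_centralizer_singleton_iff, ← Commute.conj_iff a⁻¹]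
    simp only [inv_inv, mul_assoc, inv_mul_cancel, mul_one, inv_mul_cancel_left]
    rw [Commute, SemiconjBy]
    simp only [mul_assoc]
  by_cases h : Commute g (a * x * a⁻¹)
  · rw [dif_pos (h1.2 h), if_pos h]
    have h2 := phaseProduct_conj hζ (commute_of_mem ⟨_, h1.2 h⟩) a
    simp only [mul_assoc, mul_inv_cancel, mul_one, mul_inv_cancel_left] at h2 ⊢
    exact h2.symm
  · rw [dif_neg (mt h1.1 h), if_neg h]

theorem pairWeight_conj (hζ : ∀ i, 0 < i → IsPrimitiveRoot (ζ i) i) (y g a : Perm (Fin n)) :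
    pairWeight ζ (a * y * a⁻¹) (a * g * a⁻¹) = pairWeight ζ y g := by
  have h1 : (Commute (a * g * a⁻¹) (a * y * a⁻¹) ∧
      ∀ b, Odd (cycleLength (a * y * a⁻¹) b)) ↔ Commute g y ∧ ∀ b, Odd (cycleLength y b) := by
    rw [Commute.conj_iff, a.surjective.forall]
    simp only [cycleLength_conj]
  unfold pairWeight
  by_cases h : Commute g y ∧ ∀ b, Odd (cycleLength y b)
  · rw [if_pos h, if_pos (h1.2 h), phaseProduct_conj hζ h.1, typeMonomial_eq_tMonomial,
      typeMonomial_eq_tMonomial,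
      isConj_iff_typePartition_eq.1 (isConj_iff.2 ⟨a, rfl⟩ : IsConj g (a * g * a⁻¹))]
  · rw [if_neg h, if_neg (mt h1.1 h)]

/-- The conjugacy classes with odd parts together make up all `y` with odd cycles, which is the
condition built into `pairWeight`. -/
theorem sum_psi_smul_eq (hζ : ∀ i, 0 < i → IsPrimitiveRoot (ζ i) i) (ν : n.Partition) :
    (∑ μ ∈ Nat.Partition.odds n, psi hζ μ ν) • tMonomial ν =
      ∑ y, pairWeight ζ y (representative ν) := by
  classical
  simp only [psi, psiPerm_eq_sum, isConj_representative_iff]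
  rw [Finset.sum_fiberwise_eq_sum_filter, Finset.sum_filter, Finset.sum_smul]
  refine Finset.sum_congr rfl fun y _ => ?_
  rw [pairWeight, typeMonomial_eq_tMonomial, typePartition_representative, ← ite_and, ite_smul,
    zero_smul]
  by_cases h : typePartition y ∈ Nat.Partition.odds n ∧ Commute (representative ν) y
  · rw [if_pos h, if_pos ⟨h.2, typePartition_mem_odds_iff.1 h.1⟩]
  · rw [if_neg h, if_neg fun h' => h ⟨typePartition_mem_odds_iff.2 h'.2, h'.1⟩]

open Nat in
theorem sum_psi_eq (hζ : ∀ i, 0 < i → IsPrimitiveRoot (ζ i) i) (n : ℕ) :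
    ∑ μ ∈ Nat.Partition.odds n, ∑ ν : n.Partition,
      (psi hζ μ ν / (centralizerCard ν : ℂ)) • tMonomial ν =
    (n ! : ℂ)⁻¹ • pairSum (Fin n) ζ := by
  classical
  have hfac : (n ! : ℂ) ≠ 0 := Nat.cast_ne_zero.2 (Nat.factorial_ne_zero n)
  let H : Perm (Fin n) → Series := fun g => ∑ y, pairWeight ζ y g
  -- `H` is a class function, so weighting representatives by inverse centralizer orders is the
  -- average over the group.
  have hH : ∀ a g, H (a * g * a⁻¹) = H g := fun a g => by
    change ∑ y, pairWeight ζ y (a * g * a⁻¹) = ∑ y, pairWeight ζ y g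
    rw [← Equiv.sum_comp (MulAut.conj a).toEquiv]
    exact Finset.sum_congr rfl fun y _ => pairWeight_conj hζ y g a
  have h1 : ∀ ν : n.Partition, (centralizerCard ν : ℂ)⁻¹ • H (representative ν) =
      (n ! : ℂ)⁻¹ • ∑ g with typePartition g = ν, H g := fun ν => by
    have h2 := sum_conj_eq (representative ν) H
    simp only [hH, isConj_representative_iff] at h2
    rw [Finset.sum_const, Finset.card_univ, Fintype.card_perm, Fintype.card_fin,
      ← Nat.cast_smul_eq_nsmul ℂ] at h2
    have h0 : (centralizerCard ν : ℂ) ≠ 0 := Nat.cast_ne_zero.2 Nat.card_pos.ne'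
    rw [inv_smul_eq_iff₀ h0, smul_comm, eq_inv_smul_iff₀ hfac, h2]
    rfl
  rw [Finset.sum_comm]
  trans ∑ ν : n.Partition, (centralizerCard ν : ℂ)⁻¹ • H (representative ν)
  · refine Finset.sum_congr rfl fun ν _ => ?_
    rw [← Finset.sum_smul, ← Finset.sum_div, div_eq_inv_mul, mul_smul, sum_psi_smul_eq]
  · simp_rw [h1]
    rw [← Finset.smul_sum, Finset.sum_fiberwise, pairSum, Fintype.sum_prod_type_right]

theorem sum_psi_eq_expSeq (hζ : ∀ i, 0 < i → IsPrimitiveRoot (ζ i) i) (n : ℕ) :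
    ∑ μ ∈ Nat.Partition.odds n, ∑ ν : n.Partition,
      (psi hζ μ ν / (centralizerCard ν : ℂ)) • tMonomial ν = expSeq n := by
  rw [sum_psi_eq, pairSum_eq hζ (fun β _ _ a => transSum_eq hζ a) (Fintype.card_fin n),
    inv_smul_smul₀ (Nat.cast_ne_zero.2 n.factorial_ne_zero)]

end ClassSums
end HigherLie
end

theorem theorem1p3 (ζ : ℕ → ℂ) (hζ : ∀ i, 0 < i → IsPrimitiveRoot (ζ i) i) :
    ∃ F : HigherLie.Series,
      HasSum (fun n : ℕ => ∑ μ ∈ Nat.Partition.odds n, ∑ ν : n.Partition,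
        (HigherLie.psi hζ μ ν / (HigherLie.centralizerCard ν : ℂ)) • HigherLie.tMonomial ν) F ∧
      HasProd (fun p : ℕ => HigherLie.formalPow
        ((1 + HigherLie.t (2 ^ p)) * (1 - HigherLie.t (2 ^ p))⁻¹) (1 / 2 ^ (p + 1))) F := by
  refine ⟨HigherLie.totalSeries, ?_, HigherLie.hasProd_factor⟩
  simp only [HigherLie.sum_psi_eq_expSeq]
  exact HigherLie.hasSum_expSeq
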